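/- Let $S$ be a non-empty topological space with Borel $\sigma$-field $\mathcal B(S)$, $\pi$ a probability measure on $S$, $\lambda$ Lebesgue measure on $\mathbb R$, and let $\mathcal B_b(S\times\mathbb R)$ be the Borel subsets of $S\times\mathbb R$ that are bounded in the time coordinate. Let $\Lambda=\{\Lambda(B): B\in\mathcal B_b(S\times\mathbb R)\}$ be an $\mathbb R^d$-valued Lévy basis on a probability space $(\Omega,\mathcal A,\mathbb P)$ with characteristic quadruple $(\gamma,\Sigma,\nu,\pi)$. This means that each $\Lambda(B)$ is an infinitely divisible random vector; that $\Lambda(B_1),\dots,\Lambda(B_m)$ are independent for pairwise disjoint $B_1,\dots,B_m$; that $\Lambda(\bigcup_k B_k)=\sum_k\Lambda(B_k)$ almost surely for pairwise disjoint $B_1,B_2,\ldots$ with $\bigcup_k B_k\in\mathcal B_b(S\times\mathbb R)$; and that $\mathbb E[e^{i\langle u,\Lambda(B)\rangle}]=e^{\Phi(u)\,(\pi\otimes\lambda)(B)}$ for all $u\in\mathbb R^d$ and $B\in\mathcal B_b(S\times\mathbb R)$, where $$\Phi(u)=i\langle\gamma,u\rangle-\tfrac12\langle u,\Sigma u\rangle+\int_{\mathbb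 R^d}\big(e^{i\langle u,x\rangle}-1-i\langle u,x\rangle\mathbf 1_{[0,1]}(\|x\|)\big)\,\nu(dx),$$ with $\gamma\in\mathbb R^d$, $\Sigma$ a symmetric positive semi-definite $d\times d$ matrix, and $\nu$ a Lévy measure on $\mathbb R^d$, i.e. $\nu(\{0\})=0$ and $\int(\|x\|^2\wedge1)\,\nu(dx)<\infty$. Put $L_1=\Lambda(S\times(0,1])$ and assume that $\mathbb E[L_1]=0$ and $\int_{\|x\|>1}\|x\|^2\,\nu(dx)<\infty$. Let $f:S\times\mathbb R\to M_{n\times d}(\mathbb R)$ be Borel measurable with $f\in L^2(S\times\mathbb R,\pi\otimes\lambda)$. A measurable $g:S\times\mathbb R\to M_{n\times d}(\mathbb R)$ is called $\Lambda$-integrable if there are simple functions $g_k$ (finite sums $\sum_j c_j\mathbf 1_{B_j}$ with matrices $c_j$ and pairwise disjoint $B_j\in\mathcal B_b(S\times\mathbb R)$) with $g_k\to g$ $\pi\otimes\lambda$-almost everywhere such that $\int_E g_k\,d\Lambda:=\sum_j c_j\Lambda(E\cap B_j)$ converges in probability for every Borel set $E\subseteq S\times\mathbb R$; the limit in probability for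 $E=S\times\mathbb R$ is the integral $\int_S\int_{\mathbb R}g(A,s)\,\Lambda(dA,ds)$. Then: 1. $L_1$ is square integrable and $\mathbb E[L_1L_1']=\Sigma_L$, where $\Sigma_L:=\Sigma+\int_{\mathbb R^d}xx'\,\nu(dx)$ with all entries of the integral absolutely convergent, and $(A,s)\mapsto\operatorname{tr}(f(A,-s)\Sigma_Lf(A,-s)')$ is $\pi\otimes\lambda$-integrable. 2. The mixed moving average process $X_t=\int_S\int_{\mathbb R}f(A,t-s)\,\Lambda(dA,ds)$, $t\in\mathbb R$, is well defined (the integrals exist). 3. $X$ is $\eta$-weakly dependent with coefficients $$\eta_X(r)=\Big(\int_S\int_{\mathbb R}\operatorname{tr}\big(f(A,-s)\Sigma_Lf(A,-s)'\big)\mathbf 1_{(-\infty,-r)}(2s)\,ds\,\pi(dA)\Big)^{1/2}+\Big(\int_S\int_{\mathbb R}\operatorname{tr}\big(f(A,-s)\Sigma_Lf(A,-s)'\big)\mathbf 1_{(r,\infty)}(2s)\,ds\,\pi(dA)\Big)^{1/2},\quad r\ge0.$$ That is, $\eta_X(r)\to0$ as $r\to\infty$, and there is a constant $c$ such that $$|\operatorname{Cov}(F(X_{i_1},\dots,X_{i_u}),G(X_{j_1},\dots,X_{j_v}))|\le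 c\,\big(u\operatorname{Lip}(F)\|G\|_\infty+v\operatorname{Lip}(G)\|F\|_\infty\big)\,\eta_X(r)$$ for all integers $u,v\ge1$, all $r\ge0$, all real $i_1\le\dots\le i_u\le i_u+r\le j_1\le\dots\le j_v$, and all Lipschitz functions $F:(\mathbb R^n)^u\to\mathbb R$ and $G:(\mathbb R^n)^v\to\mathbb R$ with $\|F\|_\infty,\|G\|_\infty\le1$. Here $\operatorname{Lip}(F)=\sup_{x\ne y}|F(x)-F(y)|/\sum_{a=1}^u\|x_a-y_a\|$ with Euclidean norms on $\mathbb R^n$, and likewise for $G$. -/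

import Mathlib

open MeasureTheory ProbabilityTheory Filter Topology
open scoped RealInnerProductSpace Matrix

-- Matrices carry the operator norm induced by the Euclidean norms.
open scoped Matrix.Norms.L2Operator

noncomputable section

namespace LevyMMA

/-- Bounded Borel sets of `S × ℝ`: the space `S` carries no notion of boundedness, so bounded means
bounded in the time coordinate. In particular `S × (0, t]` is bounded. -/
def IsBoundedBorel {S : Type*} [MeasurableSpace S] (B : Set (S × ℝ)) : Prop :=
  MeasurableSet B ∧ ∃ K : ℝ, ∀ p ∈ B, |p.2| ≤ K

/-- Infinite divisibility: for each `m ≥ 1`, `μ` is the law of a sum of `m` i.i.d. variables. -/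
def IsInfinitelyDivisible {d : ℕ} (μ : Measure (EuclideanSpace ℝ (Fin d))) : Prop :=
  ∀ m : ℕ, 0 < m → ∃ ρ : Measure (EuclideanSpace ℝ (Fin d)), IsProbabilityMeasure ρ ∧
    μ = (Measure.pi fun _ : Fin m => ρ).map fun x => ∑ k, x k

/-- An `ℝ^d`-valued Lévy basis on `S × ℝ` (infinitely divisible independently scattered random
measure). Only the values of `Λ` on bounded Borel sets matter. The series in the last clause is the
ordinary almost surely convergent series, not an absolutely convergent one. -/
structure IsLevyBasis {Ω S : Type*} [MeasurableSpace Ω] [MeasurableSpace S] {d : ℕ}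
    (P : Measure Ω) (Λ : Set (S × ℝ) → Ω → EuclideanSpace ℝ (Fin d)) : Prop where
  measurable : ∀ B, IsBoundedBorel B → Measurable (Λ B)
  infinitelyDivisible : ∀ B, IsBoundedBorel B → IsInfinitelyDivisible (P.map (Λ B))
  indep : ∀ (m : ℕ) (B : Fin m → Set (S × ℝ)), (∀ k, IsBoundedBorel (B k)) →
    Pairwise (fun k l => Disjoint (B k) (B l)) → iIndepFun (fun k => Λ (B k)) P
  countablyAdditive : ∀ B : ℕ → Set (S × ℝ), (∀ k, IsBoundedBorel (B k)) →
    Pairwise (fun k l => Disjoint (B k) (B l)) → IsBoundedBorel (⋃ k, B k) →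
    ∀ᵐ ω ∂P, Tendsto (fun N => ∑ k ∈ Finset.range N, Λ (B k) ω) atTop (𝓝 (Λ (⋃ k, B k) ω))

/-- `ν` is a Lévy measure on `ℝ^d`. -/
def IsLevyMeasure {d : ℕ} (ν : Measure (EuclideanSpace ℝ (Fin d))) : Prop :=
  ν {0} = 0 ∧ ∫⁻ x, ENNReal.ofReal (min (‖x‖ ^ 2) 1) ∂ν < ⊤

/-- The cumulant transform of the infinitely divisible law with triplet `(γ, Sig, ν)`, with
truncation function `1_{[0,1]}(‖x‖)`. -/
def cumulant {d : ℕ} (γ : EuclideanSpace ℝ (Fin d)) (Sig : Matrix (Fin d) (Fin d) ℝ)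
    (ν : Measure (EuclideanSpace ℝ (Fin d))) (u : EuclideanSpace ℝ (Fin d)) : ℂ :=
  Complex.I * (⟪γ, u⟫ : ℝ) - 1 / 2 * (⟪u, Matrix.toEuclideanLin Sig u⟫ : ℝ)
    + ∫ x, (Complex.exp (Complex.I * (⟪u, x⟫ : ℝ)) - 1
        - {x | ‖x‖ ≤ 1}.indicator (fun x => Complex.I * ((⟪u, x⟫ : ℝ) : ℂ)) x) ∂ν

/-- `Λ` is a time-homogeneous, factorisable Lévy basis with generating (characteristic) quadruple
`(γ, Sig, ν, π)`. -/
structure HasQuadruple {Ω S : Type*} [MeasurableSpace Ω] [MeasurableSpace S] {d : ℕ}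
    (P : Measure Ω) (Λ : Set (S × ℝ) → Ω → EuclideanSpace ℝ (Fin d))
    (γ : EuclideanSpace ℝ (Fin d)) (Sig : Matrix (Fin d) (Fin d) ℝ)
    (ν : Measure (EuclideanSpace ℝ (Fin d))) (π : Measure S) : Prop where
  isLevyBasis : IsLevyBasis P Λ
  posSemidef : Sig.PosSemidef
  isLevyMeasure : IsLevyMeasure ν
  isProbabilityMeasure : IsProbabilityMeasure π
  charFun_eq : ∀ B, IsBoundedBorel B → ∀ u : EuclideanSpace ℝ (Fin d),
    charFun (P.map (Λ B)) u
      = Complex.exp (cumulant γ Sig ν u * ((π.prod (volume : Measure ℝ)).real B : ℂ))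

/-- The underlying Lévy process at time `1`, `L_1 = Λ(S × (0, 1])`. -/
def levyOne {Ω S : Type*} {d : ℕ} (Λ : Set (S × ℝ) → Ω → EuclideanSpace ℝ (Fin d)) :
    Ω → EuclideanSpace ℝ (Fin d) :=
  Λ (Set.univ ×ˢ Set.Ioc 0 1)

/-- A matrix-valued simple function on `S × ℝ`: finitely many matrices `coef k` on pairwise disjoint
bounded Borel sets `supp k`. -/
structure SimpleKernel (S : Type*) [MeasurableSpace S] (n d : ℕ) where
  size : ℕ
  coef : Fin size → Matrix (Fin n) (Fin d) ℝ
  supp : Fin size → Set (S × ℝ)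
  bounded : ∀ k, IsBoundedBorel (supp k)
  disjoint : Pairwise fun k l => Disjoint (supp k) (supp l)

/-- The simple function itself. -/
def SimpleKernel.toFun {S : Type*} [MeasurableSpace S] {n d : ℕ} (φ : SimpleKernel S n d)
    (p : S × ℝ) : Matrix (Fin n) (Fin d) ℝ :=
  ∑ k, (φ.supp k).indicator (fun _ => φ.coef k) p

/-- The elementary integral `∫_E φ dΛ = ∑ k, coef k · Λ(E ∩ supp k)`. -/
def SimpleKernel.integral {Ω S : Type*} [MeasurableSpace S] {n d : ℕ} (φ : SimpleKernel S n d)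
    (Λ : Set (S × ℝ) → Ω → EuclideanSpace ℝ (Fin d)) (E : Set (S × ℝ)) (ω : Ω) :
    EuclideanSpace ℝ (Fin n) :=
  ∑ k, Matrix.toEuclideanLin (φ.coef k) (Λ (E ∩ φ.supp k) ω)

/-- `Y` is (a version of) the integral `∫_S ∫_ℝ g dΛ` in the sense of Rajput and Rosiński: there are
simple functions `φ k → g`, `π ⊗ λ`-almost everywhere, such that `∫_E φ k dΛ` converges in
probability for every Borel set `E`, and `Y` is the limit in probability for `E = S × ℝ`. -/
def IsLevyIntegral {Ω S : Type*} [MeasurableSpace Ω] [MeasurableSpace S] {n d : ℕ}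
    (P : Measure Ω) (π : Measure S) (Λ : Set (S × ℝ) → Ω → EuclideanSpace ℝ (Fin d))
    (g : S × ℝ → Matrix (Fin n) (Fin d) ℝ) (Y : Ω → EuclideanSpace ℝ (Fin n)) : Prop :=
  ∃ φ : ℕ → SimpleKernel S n d,
    (∀ᵐ p ∂(π.prod (volume : Measure ℝ)), Tendsto (fun k => (φ k).toFun p) atTop (𝓝 (g p))) ∧
    (∀ E : Set (S × ℝ), MeasurableSet E → ∃ Z : Ω → EuclideanSpace ℝ (Fin n),
      TendstoInMeasure P (fun k => (φ k).integral Λ E) atTop Z) ∧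
    TendstoInMeasure P (fun k => (φ k).integral Λ Set.univ) atTop Y

/-- `X` is (a version of) the mixed moving average process
`X_t = ∫_S ∫_ℝ f(A, t - s) Λ(dA, ds)`, `t ∈ ℝ`. -/
def IsMMA {Ω S : Type*} [MeasurableSpace Ω] [MeasurableSpace S] {n d : ℕ}
    (P : Measure Ω) (π : Measure S) (Λ : Set (S × ℝ) → Ω → EuclideanSpace ℝ (Fin d))
    (f : S × ℝ → Matrix (Fin n) (Fin d) ℝ) (X : ℝ → Ω → EuclideanSpace ℝ (Fin n)) : Prop :=
  ∀ t : ℝ, IsLevyIntegral P π Λ (fun p => f (p.1, t - p.2)) (X t)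

/-- The distance `δ₁(x, y) = ∑ i, ‖x i - y i‖` on `(ℝ^n)^u`. -/
def dist₁ {n u : ℕ} (x y : Fin u → EuclideanSpace ℝ (Fin n)) : ℝ :=
  ∑ a, ‖x a - y a‖

/-- `F` is Lipschitz with respect to `δ₁`. -/
def IsLip {n u : ℕ} (F : (Fin u → EuclideanSpace ℝ (Fin n)) → ℝ) : Prop :=
  ∃ K : ℝ, ∀ x y, |F x - F y| ≤ K * dist₁ x y

/-- The Lipschitz constant of a Lipschitz function `F` with respect to `δ₁`; pairs `x = y` contribute
the quotient `0 / 0 = 0` and do not change the supremum. -/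
def lipConst {n u : ℕ} (F : (Fin u → EuclideanSpace ℝ (Fin n)) → ℝ) : ℝ :=
  ⨆ p : (Fin u → EuclideanSpace ℝ (Fin n)) × (Fin u → EuclideanSpace ℝ (Fin n)),
    |F p.1 - F p.2| / dist₁ p.1 p.2

/-- The supremum norm of a bounded function `F`. -/
def supNorm {n u : ℕ} (F : (Fin u → EuclideanSpace ℝ (Fin n)) → ℝ) : ℝ :=
  ⨆ x, |F x|

/-- The process `X` is `η`-weakly dependent with coefficients `(η r)`, `r ≥ 0`. -/
def IsEtaWeaklyDependent {Ω : Type*} [MeasurableSpace Ω] {n : ℕ} (P : Measure Ω)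
    (X : ℝ → Ω → EuclideanSpace ℝ (Fin n)) (η : ℝ → ℝ) : Prop :=
  Tendsto η atTop (𝓝 0) ∧
  ∃ c : ℝ, ∀ (u v : ℕ), 0 < u → 0 < v → ∀ r : ℝ, 0 ≤ r →
    ∀ (i : Fin u → ℝ) (j : Fin v → ℝ), Monotone i → Monotone j → (∀ a b, i a + r ≤ j b) →
    ∀ (F : (Fin u → EuclideanSpace ℝ (Fin n)) → ℝ) (G : (Fin v → EuclideanSpace ℝ (Fin n)) → ℝ),
      IsLip F → IsLip G → (∀ x, |F x| ≤ 1) → (∀ x, |G x| ≤ 1) →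
      |cov[fun ω => F (fun a => X (i a) ω), fun ω => G (fun b => X (j b) ω); P]|
        ≤ c * (u * lipConst F * supNorm G + v * lipConst G * supNorm F) * η r

/-- The matrix `Σ_L = Sig + ∫ x xᵀ ν(dx)`. -/
def SigmaL {d : ℕ} (Sig : Matrix (Fin d) (Fin d) ℝ) (ν : Measure (EuclideanSpace ℝ (Fin d))) :
    Matrix (Fin d) (Fin d) ℝ :=
  Sig + Matrix.of fun a b => ∫ x, x a * x b ∂ν

/-- The integrand `tr(f(A, -s) Σ_L f(A, -s)ᵀ)`. -/
def traceKernel {S : Type*} {n d : ℕ} (f : S × ℝ → Matrix (Fin n) (Fin d) ℝ)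
    (SL : Matrix (Fin d) (Fin d) ℝ) (A : S) (s : ℝ) : ℝ :=
  (f (A, -s) * SL * (f (A, -s))ᵀ).trace

/-- The coefficients `η_X(r)`. -/
def etaCoeff {S : Type*} [MeasurableSpace S] {n d : ℕ} (π : Measure S)
    (f : S × ℝ → Matrix (Fin n) (Fin d) ℝ) (SL : Matrix (Fin d) (Fin d) ℝ) (r : ℝ) : ℝ :=
  √(∫ A, (∫ s in {s : ℝ | 2 * s < -r}, traceKernel f SL A s) ∂π)
    + √(∫ A, (∫ s in {s : ℝ | r < 2 * s}, traceKernel f SL A s) ∂π)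

end LevyMMA

end

/-! The argument is second-order `L²` theory for `Λ`, plus a cut of the time axis.

Moments come from characteristic functions. Under the moment assumption the cumulant transform
satisfies `κ(tu) = i t·mean(u) - t²·var(u)/2 + o(t²)`, with `var` the quadratic form of `Σ_L`. Since
the law of `⟪u, Λ B⟫` has characteristic function `exp(m(B) κ(tu))`, where `m = π ⊗ λ`, each `Λ B`
is square integrable. The assumption `E[L_1] = 0` kills `mean`, so polarization, additivity and
independence give `E[Λ(A) Λ(B)ᵀ] = m(A ∩ B) Σ_L`. Factoring `Σ_L = Qᵀ Q` turns this into an isometry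
(`eLpNorm_elemInt`): the `L²` norm of an elementary integral is that of its integrand multiplied by
`Qᵀ`. Density of simple kernels then yields the integrals of all `L²` kernels.

The delicate point is uniqueness. A version of `X_t` may come from any simple sequence that
converges almost everywhere and whose integrals over every `E` converge in probability; nothing
makes that sequence bounded in `L²`. Its difference with an `L²`-convergent sequence has densities
tending to `0` almost everywhere. A Vitali-Hahn-Saks theorem (Baire category on the measure algebra)
makes the differences uniformly absolutely continuous, and Egorov's theorem then forces their total
masses to `0` in probability (`tendstoInMeasure_zero_of_tendsto_ae`). So every version of `X_t` is
the isometric integral.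

For weak dependence, take `τ` at distance at least `r/2` from all the past and all the future times.
Integrals restricted to `s ≤ τ` and to `s > τ` are independent because `Λ` is independently
scattered. Restricting costs, in `L²`, at most the upper tail of `s ↦ f(A, -s)` for the past
variables and the lower tail for the future ones: the two square roots in `η_X(r)`. Replacing
bounded Lipschitz functionals by their independent approximations changes the covariance by the
stated bound, with `c = 2` (`IsMMA.abs_covariance_le`). -/

namespace LevyMMA

/-! ### Moments of a real random variable from its characteristic function. -/

section Moments

variable {Ω : Type*} [MeasurableSpace Ω] {P : Measure Ω} [IsProbabilityMeasure P] {Y : Ω → ℝ}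

theorem re_integral_cexp (hY : Measurable Y) (t : ℝ) :
    (∫ ω, Complex.exp ((t * Y ω : ℝ) * Complex.I) ∂P).re = ∫ ω, Real.cos (t * Y ω) ∂P := by
  have hi : Integrable (fun ω => Complex.exp ((t * Y ω : ℝ) * Complex.I)) P := by
    refine Integrable.of_bound (by fun_prop) 1 (ae_of_all _ fun ω => ?_)
    rw [Complex.norm_exp_ofReal_mul_I]
  have := integral_re (𝕜 := ℂ) hi
  simp only [RCLike.re_to_complex] at this
  rw [← this]
  congr with ω
  rw [Complex.exp_ofReal_mul_I_re]

theorem im_integral_cexp (hY : Measurable Y) (t : ℝ) :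
    (∫ ω, Complex.exp ((t * Y ω : ℝ) * Complex.I) ∂P).im = ∫ ω, Real.sin (t * Y ω) ∂P := by
  have hi : Integrable (fun ω => Complex.exp ((t * Y ω : ℝ) * Complex.I)) P := by
    refine Integrable.of_bound (by fun_prop) 1 (ae_of_all _ fun ω => ?_)
    rw [Complex.norm_exp_ofReal_mul_I]
  have := integral_im (𝕜 := ℂ) hi
  simp only [RCLike.im_to_complex] at this
  rw [← this]
  congr with ω
  rw [Complex.exp_ofReal_mul_I_im]

/-- By the half-angle formula the quotient is `y²/2 · sinc(ty/2)²`, and `sinc` is continuous with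
value `1` at `0`. -/
theorem tendsto_one_sub_cos_div (y : ℝ) :
    Tendsto (fun t : ℝ => (1 - Real.cos (t * y)) / t ^ 2) (𝓝[≠] 0) (𝓝 (y ^ 2 / 2)) := by
  have h : Tendsto (fun t : ℝ => y ^ 2 / 2 * Real.sinc (t * y / 2) ^ 2) (𝓝[≠] 0)
      (𝓝 (y ^ 2 / 2 * Real.sinc (0 * y / 2) ^ 2)) := by
    apply Tendsto.mono_left _ nhdsWithin_le_nhds
    exact (Continuous.tendsto (by fun_prop) 0)
  simp only [zero_mul, zero_div, Real.sinc_zero, one_pow, mul_one] at h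
  refine h.congr' ?_
  filter_upwards [self_mem_nhdsWithin] with t ht
  have ht' : t ≠ 0 := ht
  rcases eq_or_ne y 0 with rfl | hy
  · simp
  rw [Real.sinc_of_ne_zero (by positivity)]
  have : Real.cos (t * y) = 1 - 2 * Real.sin (t * y / 2) ^ 2 := by
    have := Real.cos_sq' (t * y / 2)
    have h2 := Real.cos_two_mul (t * y / 2)
    rw [show 2 * (t * y / 2) = t * y by ring] at h2
    linarith
  rw [this]
  field_simp
  ring

theorem tendsto_sin_div (y : ℝ) :
    Tendsto (fun t : ℝ => Real.sin (t * y) / t) (𝓝[≠] 0) (𝓝 y) := by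
  have h : HasDerivAt (fun t : ℝ => Real.sin (t * y)) y 0 := by
    have := (Real.hasDerivAt_sin (0 * y)).comp (0 : ℝ) ((hasDerivAt_id (0 : ℝ)).mul_const y)
    simpa [Function.comp_def] using this
  have := hasDerivAt_iff_tendsto_slope.1 h
  refine this.congr fun t => ?_
  simp [slope_def_field]

theorem one_sub_cos_le_sq (x : ℝ) : 1 - Real.cos x ≤ x ^ 2 / 2 := by
  linarith [Real.one_sub_sq_div_two_le_cos (x := x)]

/-- If `1 - Re φ(t) = O(t ^ 2)` for the characteristic function `φ`, the second moment is finite. -/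
theorem memLp_two_of_charFun_bound (hY : Measurable Y) {C : ℝ}
    (h : ∀ᶠ t : ℝ in 𝓝[≠] 0,
      1 - (∫ ω, Complex.exp ((t * Y ω : ℝ) * Complex.I) ∂P).re ≤ C * t ^ 2) :
    MemLp Y 2 P := by
  -- Fatou's lemma is applied along a sequence of nonzero points tending to `0`; integrability of
  -- `Y²` is the conclusion, so domination is not available.
  obtain ⟨t, ht⟩ := exists_seq_tendsto (𝓝[≠] (0 : ℝ))
  rw [memLp_two_iff_integrable_sq hY.aestronglyMeasurable]
  have hlim : ∀ ω, Tendsto (fun k => ENNReal.ofReal ((1 - Real.cos (t k * Y ω)) / t k ^ 2)) atTop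
      (𝓝 (ENNReal.ofReal (Y ω ^ 2 / 2))) := fun ω =>
    (ENNReal.continuous_ofReal.tendsto _).comp ((tendsto_one_sub_cos_div (Y ω)).comp ht)
  have hfat : ∫⁻ ω, ENNReal.ofReal (Y ω ^ 2 / 2) ∂P ≤ ENNReal.ofReal C := by
    calc ∫⁻ ω, ENNReal.ofReal (Y ω ^ 2 / 2) ∂P
        = ∫⁻ ω, liminf (fun k => ENNReal.ofReal ((1 - Real.cos (t k * Y ω)) / t k ^ 2)) atTop ∂P := by
          congr with ω
          exact (hlim ω).liminf_eq.symm
      _ ≤ liminf (fun k => ∫⁻ ω, ENNReal.ofReal ((1 - Real.cos (t k * Y ω)) / t k ^ 2) ∂P) atTop :=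
          lintegral_liminf_le fun k => by fun_prop
      _ ≤ ENNReal.ofReal C := by
          refine liminf_le_of_frequently_le' (Eventually.frequently ?_)
          filter_upwards [ht.eventually h, ht.eventually self_mem_nhdsWithin] with k hk hk0
          have hk0' : t k ≠ 0 := hk0
          have hint : Integrable (fun ω => Real.cos (t k * Y ω)) P :=
            Integrable.of_bound (by fun_prop) 1 (ae_of_all _ fun ω => Real.abs_cos_le_one _)
          have hint' : Integrable (fun ω => (1 - Real.cos (t k * Y ω)) / t k ^ 2) P :=
            ((integrable_const 1).sub hint).div_const _
          rw [← ofReal_integral_eq_lintegral_ofReal hint'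
            (ae_of_all _ fun ω => div_nonneg (by simpa using Real.cos_le_one _) (sq_nonneg _))]
          apply ENNReal.ofReal_le_ofReal
          rw [integral_div, integral_sub (integrable_const 1) hint]
          rw [re_integral_cexp hY] at hk
          rw [div_le_iff₀ (by positivity)]
          simpa using hk
  have h2 : Integrable (fun ω => Y ω ^ 2 / 2) P := by
    refine ⟨by fun_prop, ?_⟩
    rw [hasFiniteIntegral_iff_ofReal (ae_of_all _ fun ω => by positivity)]
    exact hfat.trans_lt ENNReal.ofReal_lt_top
  simpa using h2.mul_const 2

/-- Dominated convergence with dominating function `Y²/2`, from `1 - cos x ≤ x²/2`. -/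
theorem tendsto_charFun_second_moment (hY : MemLp Y 2 P) (hm : Measurable Y) :
    Tendsto (fun t : ℝ => (1 - (∫ ω, Complex.exp ((t * Y ω : ℝ) * Complex.I) ∂P).re) / t ^ 2)
      (𝓝[≠] 0) (𝓝 ((∫ ω, Y ω ^ 2 ∂P) / 2)) := by
  have h : Tendsto (fun t : ℝ => ∫ ω, (1 - Real.cos (t * Y ω)) / t ^ 2 ∂P)
      (𝓝[≠] 0) (𝓝 (∫ ω, Y ω ^ 2 / 2 ∂P)) := by
    refine tendsto_integral_filter_of_dominated_convergence (fun ω => Y ω ^ 2 / 2)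
      (Eventually.of_forall fun t => by fun_prop) ?_ (hY.integrable_sq.div_const 2)
      (ae_of_all _ fun ω => tendsto_one_sub_cos_div _)
    filter_upwards [self_mem_nhdsWithin] with t ht
    have ht' : t ≠ 0 := ht
    refine ae_of_all _ fun ω => ?_
    rw [Real.norm_of_nonneg (div_nonneg (by simpa using Real.cos_le_one _) (sq_nonneg _)),
      div_le_iff₀ (by positivity)]
    linarith [one_sub_cos_le_sq (t * Y ω)]
  rw [integral_div] at h
  refine h.congr fun t => ?_
  have hint : Integrable (fun ω => Real.cos (t * Y ω)) P :=
    Integrable.of_bound (by fun_prop) 1 (ae_of_all _ fun ω => Real.abs_cos_le_one _)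
  rw [re_integral_cexp hm, integral_div, integral_sub (integrable_const 1) hint]
  simp

theorem tendsto_charFun_first_moment (hY : Integrable Y P) (hm : Measurable Y) :
    Tendsto (fun t : ℝ => (∫ ω, Complex.exp ((t * Y ω : ℝ) * Complex.I) ∂P).im / t)
      (𝓝[≠] 0) (𝓝 (∫ ω, Y ω ∂P)) := by
  have h : Tendsto (fun t : ℝ => ∫ ω, Real.sin (t * Y ω) / t ∂P)
      (𝓝[≠] 0) (𝓝 (∫ ω, Y ω ∂P)) := by
    refine tendsto_integral_filter_of_dominated_convergence (fun ω => |Y ω|)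
      (Eventually.of_forall fun t => by fun_prop) ?_ hY.abs
      (ae_of_all _ fun ω => tendsto_sin_div _)
    filter_upwards [self_mem_nhdsWithin] with t ht
    have ht' : t ≠ 0 := ht
    refine ae_of_all _ fun ω => ?_
    rw [norm_div, Real.norm_eq_abs, Real.norm_eq_abs, div_le_iff₀ (abs_pos.2 ht'), mul_comm,
      ← abs_mul]
    exact Real.abs_sin_le_abs
  refine h.congr fun t => ?_
  rw [im_integral_cexp hm, integral_div]

end Moments

/-- Moments of a random variable whose characteristic function is `exp κ` near the origin with
`κ t = i t a - t ^ 2 b / 2 + o(t ^ 2)`. -/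
theorem memLp_two_of_charFun_exp {Ω : Type*} [MeasurableSpace Ω] {P : Measure Ω}
    [IsProbabilityMeasure P] {Y : Ω → ℝ} (hY : Measurable Y) {κ : ℝ → ℂ} {a b : ℝ}
    (hκ : Tendsto (fun t : ℝ => (κ t - Complex.I * t * a) / (t : ℂ) ^ 2) (𝓝[≠] 0)
      (𝓝 ((-(b / 2) : ℝ) : ℂ)))
    (h : ∀ t : ℝ, ∫ ω, Complex.exp ((t * Y ω : ℝ) * Complex.I) ∂P = Complex.exp (κ t)) :
    MemLp Y 2 P ∧ ∫ ω, Y ω ∂P = a ∧ (a = 0 → ∫ ω, Y ω ^ 2 ∂P = b) := by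
  have hid : Tendsto (fun t : ℝ => (t : ℂ)) (𝓝[≠] 0) (𝓝 0) := by
    have : Tendsto (fun t : ℝ => (t : ℂ)) (𝓝 0) (𝓝 ((0 : ℝ) : ℂ)) :=
      Complex.continuous_ofReal.tendsto 0
    simpa using this.mono_left nhdsWithin_le_nhds
  have hne : ∀ᶠ t : ℝ in 𝓝[≠] 0, t ≠ 0 := self_mem_nhdsWithin
  have hκ1 : Tendsto (fun t : ℝ => κ t / t) (𝓝[≠] 0) (𝓝 (Complex.I * a)) := by
    have := (hκ.mul hid).add_const (Complex.I * a)
    simp only [mul_zero, zero_add] at this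
    refine this.congr' ?_
    filter_upwards [hne] with t ht
    have : (t : ℂ) ≠ 0 := by exact_mod_cast ht
    field_simp
    ring
  have hκ0 : Tendsto κ (𝓝[≠] 0) (𝓝 0) := by
    have := hκ1.mul hid
    simp only [mul_zero] at this
    refine this.congr' ?_
    filter_upwards [hne] with t ht
    have : (t : ℂ) ≠ 0 := by exact_mod_cast ht
    field_simp
  have hexp : ∀ᶠ t : ℝ in 𝓝[≠] 0, ‖Complex.exp (κ t) - 1 - κ t‖ ≤ ‖κ t‖ ^ 2 := by
    have : ∀ᶠ t : ℝ in 𝓝[≠] 0, ‖κ t‖ < 1 := by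
      have := hκ0.norm.eventually (gt_mem_nhds (show ‖(0 : ℂ)‖ < 1 by simp))
      simpa using this
    filter_upwards [this] with t ht
    exact Complex.norm_exp_sub_one_sub_id_le ht.le
  -- The linear term `i t a` is purely imaginary, so real parts only see the quadratic remainder of
  -- `exp` and the `O(t²)` remainder of `κ`.
  have hre : ∀ t : ℝ, 1 - (Complex.exp (κ t)).re
      = -(Complex.exp (κ t) - 1 - κ t).re - (κ t - Complex.I * t * a).re := by
    intro t; simp
  have hL2 : MemLp Y 2 P := by
    obtain ⟨C, hC⟩ : ∃ C : ℝ, ∀ᶠ t : ℝ in 𝓝[≠] 0, ‖κ t / t‖ ≤ C :=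
      ⟨_, hκ1.norm.eventually (ge_mem_nhds (lt_add_one _))⟩
    obtain ⟨D, hD⟩ : ∃ D : ℝ, ∀ᶠ t : ℝ in 𝓝[≠] 0,
        ‖(κ t - Complex.I * t * a) / (t : ℂ) ^ 2‖ ≤ D :=
      ⟨_, hκ.norm.eventually (ge_mem_nhds (lt_add_one _))⟩
    refine memLp_two_of_charFun_bound hY (C := C ^ 2 + D) ?_
    filter_upwards [hC, hD, hexp, hne] with t h1 h2 h3 ht
    rw [h t, hre]
    rw [norm_div, Complex.norm_real, div_le_iff₀ (norm_pos_iff.2 ht)] at h1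
    rw [norm_div, norm_pow, Complex.norm_real, div_le_iff₀ (by positivity), Real.norm_eq_abs,
      sq_abs] at h2
    have h4 : ‖κ t‖ ^ 2 ≤ C ^ 2 * t ^ 2 := by
      calc ‖κ t‖ ^ 2 ≤ (C * ‖t‖) ^ 2 := by gcongr
        _ = C ^ 2 * t ^ 2 := by rw [mul_pow, Real.norm_eq_abs, sq_abs]
    have h5 := Complex.abs_re_le_norm (Complex.exp (κ t) - 1 - κ t)
    have h6 := Complex.abs_re_le_norm (κ t - Complex.I * t * a)
    have h7 := neg_abs_le (Complex.exp (κ t) - 1 - κ t).re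
    have h8 := neg_abs_le (κ t - Complex.I * t * a).re
    nlinarith
  have hmean : ∫ ω, Y ω ∂P = a := by
    have h1 := tendsto_charFun_first_moment (hL2.integrable one_le_two) hY
    have h2 : Tendsto (fun t : ℝ => (Complex.exp (κ t) - 1) / t) (𝓝[≠] 0)
        (𝓝 (Complex.I * a)) := by
      have h3 : Tendsto (fun t : ℝ => (Complex.exp (κ t) - 1 - κ t) / t) (𝓝[≠] 0) (𝓝 0) := by
        refine squeeze_zero_norm' (a := fun t : ℝ => ‖κ t / t‖ * ‖κ t‖) ?_ ?_
        · filter_upwards [hexp, hne] with t h3 ht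
          rw [norm_div, norm_div]
          calc ‖Complex.exp (κ t) - 1 - κ t‖ / ‖(t : ℂ)‖ ≤ ‖κ t‖ ^ 2 / ‖(t : ℂ)‖ := by gcongr
            _ = _ := by ring
        · have := hκ1.norm.mul hκ0.norm
          simpa using this
      have := h3.add hκ1
      rw [zero_add] at this
      refine this.congr fun t => ?_
      ring
    have h3 := (Complex.continuous_im.tendsto _).comp h2
    refine tendsto_nhds_unique h1 ?_
    have h4 : (Complex.I * a).im = a := by simp
    rw [h4] at h3
    refine h3.congr fun t => ?_
    simp only [Function.comp, h t]
    rw [Complex.div_ofReal_im]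
    simp
  refine ⟨hL2, hmean, fun ha => ?_⟩
  subst ha
  have h1 := tendsto_charFun_second_moment hL2 hY
  -- For `a = 0` one has `κ t / t → 0`, so the quadratic term of `exp`, of order `‖κ t / t‖²`,
  -- disappears. For general `a` it would contribute `a²`.
  have h2 : Tendsto (fun t : ℝ => (1 - Complex.exp (κ t)) / (t : ℂ) ^ 2) (𝓝[≠] 0)
      (𝓝 ((b / 2 : ℝ) : ℂ)) := by
    have h3 : Tendsto (fun t : ℝ => (Complex.exp (κ t) - 1 - κ t) / (t : ℂ) ^ 2) (𝓝[≠] 0)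
        (𝓝 0) := by
      refine squeeze_zero_norm' (a := fun t : ℝ => ‖κ t / t‖ ^ 2) ?_ ?_
      · filter_upwards [hexp, hne] with t h3 ht
        rw [norm_div, norm_div, norm_pow, div_pow]
        gcongr
      · have := hκ1.norm.pow 2
        simpa using this
    have := (h3.add hκ).neg
    rw [zero_add, ← Complex.ofReal_neg, neg_neg] at this
    refine this.congr fun t => ?_
    simp
    ring
  have h3 := (Complex.continuous_re.tendsto _).comp h2
  have h4 : (∫ ω, Y ω ^ 2 ∂P) / 2 = b / 2 := by
    refine tendsto_nhds_unique h1 ?_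
    rw [Complex.ofReal_re] at h3
    refine h3.congr fun t => ?_
    simp only [Function.comp, h t]
    rw [← Complex.ofReal_pow, Complex.div_ofReal_re]
    simp
  linarith

/-! ### Second-order expansion of the cumulant transform. -/

theorem norm_cexp_I_sub_one_sub_le (y : ℝ) :
    ‖Complex.exp (Complex.I * y) - 1 - Complex.I * y‖ ≤ 2 * y ^ 2 := by
  -- Taylor's bound for small `y` and the triangle inequality for large `y`. A bound valid for all
  -- `y` is needed, since it serves as the `ν`-integrable dominating function.
  rcases le_or_gt |y| 1 with h | h
  · have h1 : ‖Complex.I * (y : ℂ)‖ = |y| := by simp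
    have := Complex.norm_exp_sub_one_sub_id_le (h1.trans_le h)
    rw [h1, sq_abs] at this
    nlinarith [sq_nonneg y]
  · calc ‖Complex.exp (Complex.I * y) - 1 - Complex.I * y‖
        ≤ ‖Complex.exp (Complex.I * y) - 1‖ + ‖Complex.I * (y : ℂ)‖ := norm_sub_le _ _
      _ ≤ |y| + |y| := by
          gcongr
          · simpa using Real.norm_exp_I_mul_ofReal_sub_one_le (x := y)
          · simp
      _ ≤ 2 * y ^ 2 := by
          rw [← sq_abs]; nlinarith

theorem tendsto_cexp_I_sub_one_sub_div (y : ℝ) :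
    Tendsto (fun t : ℝ => (Complex.exp (Complex.I * (t * y : ℝ)) - 1 - Complex.I * (t * y : ℝ))
      / (t : ℂ) ^ 2) (𝓝[≠] 0) (𝓝 (-(y : ℂ) ^ 2 / 2)) := by
  rw [tendsto_iff_norm_sub_tendsto_zero]
  have hz : Tendsto (fun t : ℝ => |y| ^ 3 * |t|) (𝓝[≠] 0) (𝓝 0) := by
    have : Tendsto (fun t : ℝ => |y| ^ 3 * |t|) (𝓝 0) (𝓝 (|y| ^ 3 * |0|)) :=
      Continuous.tendsto (by fun_prop) 0
    simpa using this.mono_left nhdsWithin_le_nhds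
  refine squeeze_zero' (Eventually.of_forall fun t => norm_nonneg _) ?_ hz
  have hsmall : ∀ᶠ t : ℝ in 𝓝[≠] 0, |t * y| < 1 := by
    have : Tendsto (fun t : ℝ => |t * y|) (𝓝 0) (𝓝 |0 * y|) :=
      Continuous.tendsto (by fun_prop) 0
    exact (this.mono_left nhdsWithin_le_nhds).eventually (gt_mem_nhds (by simp))
  filter_upwards [hsmall, self_mem_nhdsWithin] with t ht ht0
  have ht0' : (t : ℂ) ≠ 0 := by exact_mod_cast (show t ≠ 0 from ht0)
  have hb := Complex.exp_bound (x := Complex.I * (t * y : ℝ)) (by simpa using ht.le)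
    (n := 3) (by norm_num)
  have h1 : ‖Complex.I * ((t * y : ℝ) : ℂ)‖ = |t * y| := by
    rw [norm_mul, Complex.norm_I, one_mul, Complex.norm_real, Real.norm_eq_abs]
  rw [h1] at hb
  have h2 : (Complex.exp (Complex.I * (t * y : ℝ)) - 1 - Complex.I * (t * y : ℝ)) / (t : ℂ) ^ 2
      - -(y : ℂ) ^ 2 / 2 = (Complex.exp (Complex.I * (t * y : ℝ))
        - ∑ m ∈ Finset.range 3, (Complex.I * ((t * y : ℝ) : ℂ)) ^ m / (m.factorial : ℂ))
        / (t : ℂ) ^ 2 := by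
    simp only [Finset.sum_range_succ, Finset.range_zero, Finset.sum_empty, Nat.factorial]
    push_cast
    field_simp
    have : Complex.I ^ 2 = -1 := Complex.I_sq
    ring_nf
    rw [this]
    ring
  rw [h2, norm_div, norm_pow, Complex.norm_real, div_le_iff₀ (by positivity)]
  refine hb.trans ?_
  have : (0 : ℝ) ≤ |t| ^ 3 * |y| ^ 3 := by positivity
  rw [abs_mul, mul_pow, Real.norm_eq_abs]
  -- The constant in the third-order Taylor remainder is `4 / (3! · 3)`, which is at most `1`.
  calc |t| ^ 3 * |y| ^ 3 * (((Nat.succ 3 : ℕ) : ℝ) * (((Nat.factorial 3 : ℕ) : ℝ) * (3 : ℕ))⁻¹)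
      ≤ |t| ^ 3 * |y| ^ 3 * 1 := by
        gcongr
        norm_num [Nat.factorial]
    _ = |y| ^ 3 * |t| * |t| ^ 2 := by ring

section Cumulant

variable {d : ℕ} {γ : EuclideanSpace ℝ (Fin d)} {Sig : Matrix (Fin d) (Fin d) ℝ}
  {ν : Measure (EuclideanSpace ℝ (Fin d))}

/-- The Lévy condition controls the unit ball, where `min(‖x‖², 1) = ‖x‖²`; the moment assumption
controls the rest. -/
theorem integrable_norm_sq (hν : IsLevyMeasure ν)
    (hmoment : IntegrableOn (fun x => ‖x‖ ^ 2) {x | 1 < ‖x‖} ν) :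
    Integrable (fun x => ‖x‖ ^ 2) ν := by
  rw [← integrableOn_univ, show (Set.univ : Set (EuclideanSpace ℝ (Fin d)))
    = {x | ‖x‖ ≤ 1} ∪ {x | 1 < ‖x‖} by ext x; simp [le_or_gt]]
  refine IntegrableOn.union ?_ hmoment
  have h1 : Integrable (fun x => min (‖x‖ ^ 2) 1) ν := by
    refine ⟨by fun_prop, ?_⟩
    rw [hasFiniteIntegral_iff_ofReal (ae_of_all _ fun x => by positivity)]
    exact hν.2
  refine h1.integrableOn.congr_fun (fun x hx => ?_) (measurableSet_le (by fun_prop) (by fun_prop))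
  have : ‖x‖ ^ 2 ≤ 1 := by
    have := Set.mem_ofPred_eq ▸ hx
    exact pow_le_one₀ (norm_nonneg _) this
  simp [this]

/-- The mean of `⟪u, L_1⟫` in terms of the triplet. -/
noncomputable def cumulantMean (γ : EuclideanSpace ℝ (Fin d))
    (ν : Measure (EuclideanSpace ℝ (Fin d))) (u : EuclideanSpace ℝ (Fin d)) : ℝ :=
  ⟪γ, u⟫ + ∫ x in {x | 1 < ‖x‖}, ⟪u, x⟫ ∂ν

/-- The variance of `⟪u, L_1⟫` in terms of the triplet. -/
noncomputable def cumulantVar (Sig : Matrix (Fin d) (Fin d) ℝ)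
    (ν : Measure (EuclideanSpace ℝ (Fin d))) (u : EuclideanSpace ℝ (Fin d)) : ℝ :=
  ⟪u, Matrix.toEuclideanLin Sig u⟫ + ∫ x, ⟪u, x⟫ ^ 2 ∂ν

theorem integrable_inner_sq (h2 : Integrable (fun x => ‖x‖ ^ 2) ν)
    (u : EuclideanSpace ℝ (Fin d)) : Integrable (fun x => ⟪u, x⟫ ^ 2) ν := by
  refine (h2.const_mul (‖u‖ ^ 2)).mono' (by fun_prop) (ae_of_all _ fun x => ?_)
  rw [Real.norm_of_nonneg (sq_nonneg _), ← mul_pow, ← sq_abs]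
  gcongr
  exact abs_real_inner_le_norm u x

/-- With finite second moment the compensator can be subtracted on all of `ℝ^d` instead of on the
unit ball only. The large-jump part added back becomes the correction of `γ` in `cumulantMean`. -/
theorem cumulant_smul (h2 : Integrable (fun x => ‖x‖ ^ 2) ν)
    (u : EuclideanSpace ℝ (Fin d)) (t : ℝ) :
    cumulant γ Sig ν (t • u) = Complex.I * t * cumulantMean γ ν u
      + ((t : ℂ) ^ 2 * (-(1 / 2) * (⟪u, Matrix.toEuclideanLin Sig u⟫ : ℝ))
      + ∫ x, (Complex.exp (Complex.I * (t * ⟪u, x⟫ : ℝ)) - 1 - Complex.I * (t * ⟪u, x⟫ : ℝ)) ∂ν) := by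
  have hms : MeasurableSet {x : EuclideanSpace ℝ (Fin d) | 1 < ‖x‖} :=
    measurableSet_lt (by fun_prop) (by fun_prop)
  have hA : Integrable (fun x => Complex.exp (Complex.I * (t * ⟪u, x⟫ : ℝ)) - 1
      - Complex.I * (t * ⟪u, x⟫ : ℝ)) ν := by
    refine ((integrable_inner_sq h2 u).const_mul (2 * t ^ 2)).mono' (by fun_prop)
      (ae_of_all _ fun x => ?_)
    refine (norm_cexp_I_sub_one_sub_le _).trans_eq ?_
    ring
  have hB0 : IntegrableOn (fun x => ⟪u, x⟫) {x | 1 < ‖x‖} ν := by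
    refine Integrable.mono' (h2.integrableOn.const_mul ‖u‖) (by fun_prop) ?_
    filter_upwards [ae_restrict_mem hms] with x hx
    have hx' : 1 < ‖x‖ := hx
    calc ‖⟪u, x⟫‖ ≤ ‖u‖ * ‖x‖ := norm_inner_le_norm u x
      _ ≤ ‖u‖ * ‖x‖ ^ 2 := by gcongr; nlinarith
  have hB : Integrable ({x | 1 < ‖x‖}.indicator
      (fun x => Complex.I * t * ((⟪u, x⟫ : ℝ) : ℂ))) ν := by
    rw [integrable_indicator_iff hms]
    exact hB0.ofReal.const_mul _
  have hsplit : ∀ x : EuclideanSpace ℝ (Fin d),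
      Complex.exp (Complex.I * (⟪t • u, x⟫ : ℝ)) - 1
        - {x : EuclideanSpace ℝ (Fin d) | ‖x‖ ≤ 1}.indicator
            (fun x => Complex.I * ((⟪t • u, x⟫ : ℝ) : ℂ)) x
      = (Complex.exp (Complex.I * (t * ⟪u, x⟫ : ℝ)) - 1 - Complex.I * (t * ⟪u, x⟫ : ℝ))
        + {x | 1 < ‖x‖}.indicator (fun x => Complex.I * t * ((⟪u, x⟫ : ℝ) : ℂ)) x := by
    intro x
    simp only [Set.indicator_apply, Set.mem_ofPred_eq, real_inner_smul_left]
    by_cases hx : ‖x‖ ≤ 1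
    · simp [hx]
    · simp [hx, not_le.1 hx]; ring
  rw [cumulant, integral_congr_ae (ae_of_all _ hsplit), integral_add hA hB,
    integral_indicator hms, integral_const_mul, integral_complex_ofReal, cumulantMean]
  simp only [real_inner_smul_left, real_inner_smul_right, map_smul]
  push_cast
  ring

theorem tendsto_cumulant (h2 : Integrable (fun x => ‖x‖ ^ 2) ν)
    (u : EuclideanSpace ℝ (Fin d)) :
    Tendsto (fun t : ℝ => (cumulant γ Sig ν (t • u) - Complex.I * t * cumulantMean γ ν u)
      / (t : ℂ) ^ 2) (𝓝[≠] 0) (𝓝 ((-(cumulantVar Sig ν u / 2) : ℝ) : ℂ)) := by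
  have h : Tendsto (fun t : ℝ => ∫ x, (Complex.exp (Complex.I * (t * ⟪u, x⟫ : ℝ)) - 1
      - Complex.I * (t * ⟪u, x⟫ : ℝ)) / (t : ℂ) ^ 2 ∂ν) (𝓝[≠] 0)
      (𝓝 (∫ x, -((⟪u, x⟫ : ℝ) : ℂ) ^ 2 / 2 ∂ν)) := by
    refine tendsto_integral_filter_of_dominated_convergence (fun x => 2 * ⟪u, x⟫ ^ 2)
      (Eventually.of_forall fun t => by fun_prop) ?_ ((integrable_inner_sq h2 u).const_mul 2)
      (ae_of_all _ fun x => tendsto_cexp_I_sub_one_sub_div _)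
    filter_upwards [self_mem_nhdsWithin] with t ht
    have ht' : t ≠ 0 := ht
    refine ae_of_all _ fun x => ?_
    rw [norm_div, norm_pow, Complex.norm_real, Real.norm_eq_abs, sq_abs,
      div_le_iff₀ (by positivity)]
    refine (norm_cexp_I_sub_one_sub_le _).trans_eq ?_
    ring
  have h' := h.const_add (-(1 / 2) * ((⟪u, Matrix.toEuclideanLin Sig u⟫ : ℝ) : ℂ))
  have he : -(1 / 2) * ((⟪u, Matrix.toEuclideanLin Sig u⟫ : ℝ) : ℂ)
      + ∫ x, -((⟪u, x⟫ : ℝ) : ℂ) ^ 2 / 2 ∂ν = ((-(cumulantVar Sig ν u / 2) : ℝ) : ℂ) := by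
    have h3 : ∫ x, -((⟪u, x⟫ : ℝ) : ℂ) ^ 2 / 2 ∂ν = ((-((∫ x, ⟪u, x⟫ ^ 2 ∂ν) / 2) : ℝ) : ℂ) := by
      rw [← integral_div, ← integral_neg, ← integral_complex_ofReal]
      congr with x
      push_cast
      ring
    rw [h3, cumulantVar]
    push_cast
    ring
  rw [he] at h'
  refine h'.congr' ?_
  filter_upwards [self_mem_nhdsWithin] with t ht
  have ht' : (t : ℂ) ≠ 0 := by exact_mod_cast (show t ≠ 0 from ht)
  rw [cumulant_smul h2, integral_div]
  field_simp
  ring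

end Cumulant

/-! ### First and second moments of the Lévy basis on one set. -/

section LevyBasisMoments

variable {Ω S : Type*} [MeasurableSpace Ω] [MeasurableSpace S] {d : ℕ}
  {P : Measure Ω} [IsProbabilityMeasure P]
  {Λ : Set (S × ℝ) → Ω → EuclideanSpace ℝ (Fin d)}
  {γ : EuclideanSpace ℝ (Fin d)} {Sig : Matrix (Fin d) (Fin d) ℝ}
  {ν : Measure (EuclideanSpace ℝ (Fin d))} {π : Measure S}

/-- On the ray `t • u` the characteristic function of `Λ B` is that of the scalar `⟪u, Λ B⟫`. Its
exponent is the cumulant times the mass of `B`, so both expansion coefficients scale with that mass.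
-/
theorem HasQuadruple.moments_inner (hΛ : HasQuadruple P Λ γ Sig ν π)
    (h2 : Integrable (fun x => ‖x‖ ^ 2) ν) {B : Set (S × ℝ)} (hB : IsBoundedBorel B)
    (u : EuclideanSpace ℝ (Fin d)) :
    MemLp (fun ω => ⟪u, Λ B ω⟫) 2 P ∧
      ∫ ω, ⟪u, Λ B ω⟫ ∂P = (π.prod (volume : Measure ℝ)).real B * cumulantMean γ ν u ∧
      (cumulantMean γ ν u = 0 → ∫ ω, ⟪u, Λ B ω⟫ ^ 2 ∂P
        = (π.prod (volume : Measure ℝ)).real B * cumulantVar Sig ν u) := by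
  have hm := hΛ.isLevyBasis.measurable B hB
  set m := (π.prod (volume : Measure ℝ)).real B
  have h := memLp_two_of_charFun_exp (P := P) (Y := fun ω => ⟪u, Λ B ω⟫)
    (κ := fun t => cumulant γ Sig ν (t • u) * (m : ℂ)) (a := m * cumulantMean γ ν u)
    (b := m * cumulantVar Sig ν u) (by fun_prop) ?_ ?_
  · refine ⟨h.1, h.2.1, fun h0 => h.2.2 (by rw [h0, mul_zero])⟩
  · have := (tendsto_cumulant (γ := γ) (Sig := Sig) h2 u).mul_const (m : ℂ)
    rw [← Complex.ofReal_mul, show -(cumulantVar Sig ν u / 2) * m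
      = -(m * cumulantVar Sig ν u / 2) by ring] at this
    refine this.congr fun t => ?_
    push_cast
    ring
  · intro t
    rw [← hΛ.charFun_eq B hB (t • u), charFun_apply,
      integral_map hm.aemeasurable (by fun_prop)]
    congr with ω
    rw [real_inner_smul_right, real_inner_comm]

theorem isBoundedBorel_unit :
    IsBoundedBorel (Set.univ ×ˢ Set.Ioc 0 1 : Set (S × ℝ)) := by
  refine ⟨MeasurableSet.univ.prod measurableSet_Ioc, 1, fun p hp => ?_⟩
  have := hp.2
  rw [abs_of_pos this.1]
  exact this.2

theorem HasQuadruple.memLp (hΛ : HasQuadruple P Λ γ Sig ν π)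
    (h2 : Integrable (fun x => ‖x‖ ^ 2) ν) {B : Set (S × ℝ)} (hB : IsBoundedBorel B) :
    MemLp (Λ B) 2 P := by
  refine MemLp.of_eval_piLp fun a => ?_
  have := (hΛ.moments_inner h2 hB (EuclideanSpace.single a 1)).1
  simpa [EuclideanSpace.inner_single_left] using this

theorem measureReal_unit [IsProbabilityMeasure π] :
    (π.prod (volume : Measure ℝ)).real (Set.univ ×ˢ Set.Ioc 0 1 : Set (S × ℝ)) = 1 := by
  rw [measureReal_prod_prod]
  simp

/-- The set `S × (0, 1]` has mass `1`, so the mean of `⟪u, L_1⟫` is exactly `cumulantMean`. Through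
the scaling in `moments_inner`, centring `L_1` centres every `Λ B`. -/
theorem HasQuadruple.cumulantMean_eq_zero (hΛ : HasQuadruple P Λ γ Sig ν π)
    (h2 : Integrable (fun x => ‖x‖ ^ 2) ν) (hmean : ∫ ω, levyOne Λ ω ∂P = 0)
    (u : EuclideanSpace ℝ (Fin d)) : cumulantMean γ ν u = 0 := by
  have := hΛ.isProbabilityMeasure
  have h := (hΛ.moments_inner h2 isBoundedBorel_unit u).2.1
  rw [measureReal_unit, one_mul] at h
  rw [← h, integral_inner ((hΛ.memLp h2 isBoundedBorel_unit).integrable one_le_two)]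
  change ⟪u, ∫ ω, levyOne Λ ω ∂P⟫ = 0
  rw [hmean, inner_zero_right]

theorem integrable_coord_mul (h2 : Integrable (fun x => ‖x‖ ^ 2) ν) (a b : Fin d) :
    Integrable (fun x : EuclideanSpace ℝ (Fin d) => x a * x b) ν := by
  refine h2.mono' (by fun_prop) (ae_of_all _ fun x => ?_)
  rw [norm_mul, sq]
  gcongr <;> exact PiLp.norm_apply_le x _

theorem cumulantVar_eq (h2 : Integrable (fun x => ‖x‖ ^ 2) ν) (u : EuclideanSpace ℝ (Fin d)) :
    cumulantVar Sig ν u = ∑ a, ∑ b, u a * u b * SigmaL Sig ν a b := by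
  have h1 : ∀ x : EuclideanSpace ℝ (Fin d),
      ⟪u, x⟫ ^ 2 = ∑ a, ∑ b, u a * u b * (x a * x b) := by
    intro x
    rw [PiLp.inner_apply, sq, Finset.sum_mul_sum]
    refine Finset.sum_congr rfl fun a _ => Finset.sum_congr rfl fun b _ => ?_
    simp
    ring
  rw [cumulantVar, integral_congr_ae (ae_of_all _ h1), integral_finsetSum _ fun a _ =>
    integrable_finsetSum _ fun b _ => (integrable_coord_mul h2 a b).const_mul _]
  simp_rw [integral_finsetSum _ fun b _ => (integrable_coord_mul h2 _ b).const_mul _,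
    integral_const_mul]
  rw [PiLp.inner_apply, ← Finset.sum_add_distrib]
  refine Finset.sum_congr rfl fun a _ => ?_
  simp only [Matrix.toLpLin_apply, Matrix.mulVec, dotProduct, SigmaL, Matrix.add_apply,
    Matrix.of_apply, mul_add, Finset.sum_add_distrib, RCLike.inner_apply, conj_trivial]
  congr 1
  rw [Finset.sum_mul]
  refine Finset.sum_congr rfl fun b _ => by ring

theorem sigmaL_symm (hS : Sig.PosSemidef) (a b : Fin d) :
    SigmaL Sig ν a b = SigmaL Sig ν b a := by
  have := hS.1.apply a b
  simp only [SigmaL, Matrix.add_apply, Matrix.of_apply, star_trivial] at this ⊢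
  rw [this]
  simp_rw [mul_comm]

/-- Second moments of the Lévy basis on a single set. -/
theorem HasQuadruple.integral_coord_mul_self (hΛ : HasQuadruple P Λ γ Sig ν π)
    (h2 : Integrable (fun x => ‖x‖ ^ 2) ν) (hmean : ∫ ω, levyOne Λ ω ∂P = 0)
    {B : Set (S × ℝ)} (hB : IsBoundedBorel B) (a b : Fin d) :
    ∫ ω, Λ B ω a * Λ B ω b ∂P = (π.prod (volume : Measure ℝ)).real B * SigmaL Sig ν a b := by
  set m := (π.prod (volume : Measure ℝ)).real B
  have hL := hΛ.memLp h2 hB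
  have hc : ∀ a, MemLp (fun ω => Λ B ω a) 2 P := fun a => hL.eval_piLp a
  have key : ∀ u : EuclideanSpace ℝ (Fin d),
      ∫ ω, ⟪u, Λ B ω⟫ ^ 2 ∂P = m * ∑ a, ∑ b, u a * u b * SigmaL Sig ν a b := fun u => by
    rw [← cumulantVar_eq h2]
    exact (hΛ.moments_inner h2 hB u).2.2 (hΛ.cumulantMean_eq_zero h2 hmean u)
  have hs : ∀ a, ∫ ω, Λ B ω a ^ 2 ∂P = m * SigmaL Sig ν a a := fun a => by
    have := key (EuclideanSpace.single a 1)
    simpa [EuclideanSpace.inner_single_left, PiLp.single_apply] using this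
  rcases eq_or_ne a b with rfl | hab
  · simpa [sq] using hs a
  -- Polarization: the variance in direction `e_a + e_b`, minus those in directions `e_a` and `e_b`,
  -- gives twice the mixed moment.
  have h := key (EuclideanSpace.single a 1 + EuclideanSpace.single b 1)
  have e1 : ∀ ω, ⟪(EuclideanSpace.single a 1 + EuclideanSpace.single b 1 :
      EuclideanSpace ℝ (Fin d)), Λ B ω⟫ ^ 2
      = Λ B ω a ^ 2 + Λ B ω b ^ 2 + 2 * (Λ B ω a * Λ B ω b) := fun ω => by
    rw [inner_add_left, EuclideanSpace.inner_single_left, EuclideanSpace.inner_single_left]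
    simp
    ring
  have i1 : Integrable (fun ω => Λ B ω a ^ 2 + Λ B ω b ^ 2) P :=
    (hc a).integrable_sq.add (hc b).integrable_sq
  have i2 : Integrable (fun ω => 2 * (Λ B ω a * Λ B ω b)) P :=
    ((hc a).integrable_mul (hc b)).const_mul 2
  rw [integral_congr_ae (ae_of_all _ e1), integral_add i1 i2,
    integral_add (hc a).integrable_sq (hc b).integrable_sq, integral_const_mul, hs, hs] at h
  have e2 : ∑ x, ∑ y, (EuclideanSpace.single a 1 + EuclideanSpace.single b 1 :
      EuclideanSpace ℝ (Fin d)) x * (EuclideanSpace.single a 1 + EuclideanSpace.single b 1 :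
      EuclideanSpace ℝ (Fin d)) y * SigmaL Sig ν x y
      = SigmaL Sig ν a a + SigmaL Sig ν b b + 2 * SigmaL Sig ν a b := by
    simp only [PiLp.add_apply, PiLp.single_apply, add_mul, mul_add, Finset.sum_add_distrib,
      ite_mul, mul_ite, one_mul, mul_one, zero_mul, mul_zero, Finset.sum_ite_eq',
      Finset.mem_univ, if_true]
    rw [sigmaL_symm hΛ.posSemidef b a]
    ring
  rw [e2] at h
  linarith

end LevyBasisMoments

/-! ### Gram matrices and `L²` norms of finite sums. -/

section Gram

variable {α : Type*} [MeasurableSpace α] {μ : Measure α} {β : Type*} [MeasurableSpace β]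
  {μ' : Measure β} {E F : Type*} [NormedAddCommGroup E] [InnerProductSpace ℝ E]
  [NormedAddCommGroup F] [InnerProductSpace ℝ F]

theorem integrable_inner_of_memLp {f g : α → E} (hf : MemLp f 2 μ) (hg : MemLp g 2 μ) :
    Integrable (fun x => ⟪f x, g x⟫) μ := by
  refine (hf.norm.integrable_mul hg.norm).mono' (hf.1.inner hg.1) (ae_of_all _ fun x => ?_)
  exact norm_inner_le_norm _ _

theorem integral_norm_sq_sum {ι : Type*} [Fintype ι] {X : ι → α → E}
    (hX : ∀ k, MemLp (X k) 2 μ) :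
    ∫ x, ‖∑ k, X k x‖ ^ 2 ∂μ = ∑ k, ∑ l, ∫ x, ⟪X k x, X l x⟫ ∂μ := by
  have h : ∀ x, ‖∑ k, X k x‖ ^ 2 = ∑ k, ∑ l, ⟪X k x, X l x⟫ := fun x => by
    rw [← real_inner_self_eq_norm_sq, sum_inner]
    simp_rw [inner_sum]
  rw [integral_congr_ae (ae_of_all _ h), integral_finsetSum _ fun k _ =>
    integrable_finsetSum _ fun l _ => integrable_inner_of_memLp (hX k) (hX l)]
  refine Finset.sum_congr rfl fun k _ => ?_
  rw [integral_finsetSum _ fun l _ => integrable_inner_of_memLp (hX k) (hX l)]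

/-- Finite families with the same Gram matrix have sums with the same `L²` norm. -/
theorem eLpNorm_sum_eq_of_gram {ι : Type*} [Fintype ι] {X : ι → α → E} {Y : ι → β → F}
    (hX : ∀ k, MemLp (X k) 2 μ) (hY : ∀ k, MemLp (Y k) 2 μ')
    (h : ∀ k l, ∫ x, ⟪X k x, X l x⟫ ∂μ = ∫ x, ⟪Y k x, Y l x⟫ ∂μ') :
    eLpNorm (fun x => ∑ k, X k x) 2 μ = eLpNorm (fun x => ∑ k, Y k x) 2 μ' := by
  have h1 : MemLp (fun x => ∑ k, X k x) 2 μ := memLp_finsetSum _ fun k _ => hX k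
  have h2 : MemLp (fun x => ∑ k, Y k x) 2 μ' := memLp_finsetSum _ fun k _ => hY k
  rw [h1.eLpNorm_eq_integral_rpow_norm (by simp) (by simp),
    h2.eLpNorm_eq_integral_rpow_norm (by simp) (by simp)]
  simp only [ENNReal.toReal_ofNat, Real.rpow_ofNat]
  rw [integral_norm_sq_sum hX, integral_norm_sq_sum hY]
  simp_rw [h]

end Gram

/-- A square integrable random measure on bounded Borel sets, with orthogonal increments of
covariance `Qᵀ Q` with respect to the intensity `m`. -/
structure IsOrthogonalBasis {Ω S : Type*} [MeasurableSpace Ω] [MeasurableSpace S] {d : ℕ}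
    (P : Measure Ω) (m : Measure (S × ℝ)) (Λ : Set (S × ℝ) → Ω → EuclideanSpace ℝ (Fin d))
    (Q : Matrix (Fin d) (Fin d) ℝ) : Prop where
  measurable : ∀ B, IsBoundedBorel B → Measurable (Λ B)
  memLp : ∀ B, IsBoundedBorel B → MemLp (Λ B) 2 P
  covariance : ∀ B B', IsBoundedBorel B → IsBoundedBorel B' → ∀ a b,
    ∫ ω, Λ B ω a * Λ B' ω b ∂P = m.real (B ∩ B') * (Qᵀ * Q) a b
  finite : ∀ B, IsBoundedBorel B → m B ≠ ⊤

/-! ### Bounded Borel sets and finite additivity of a Lévy basis. -/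

section Additivity

variable {Ω S : Type*} [MeasurableSpace Ω] [MeasurableSpace S] {d : ℕ}
  {P : Measure Ω} {Λ : Set (S × ℝ) → Ω → EuclideanSpace ℝ (Fin d)}

theorem IsBoundedBorel.empty : IsBoundedBorel (∅ : Set (S × ℝ)) :=
  ⟨MeasurableSet.empty, 0, by simp⟩

theorem IsBoundedBorel.mono {A B : Set (S × ℝ)} (hB : IsBoundedBorel B) (hA : MeasurableSet A)
    (h : A ⊆ B) : IsBoundedBorel A :=
  ⟨hA, hB.2.imp fun _ hK p hp => hK p (h hp)⟩

theorem IsBoundedBorel.union {A B : Set (S × ℝ)} (hA : IsBoundedBorel A)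
    (hB : IsBoundedBorel B) : IsBoundedBorel (A ∪ B) := by
  obtain ⟨hA, K, hK⟩ := hA
  obtain ⟨hB, L, hL⟩ := hB
  refine ⟨hA.union hB, max K L, fun p hp => ?_⟩
  rcases hp with hp | hp
  · exact (hK p hp).trans (le_max_left _ _)
  · exact (hL p hp).trans (le_max_right _ _)

/-- Apply countable additivity to the constant sequence `∅`: the partial sums converge, so their
increments, all equal to `Λ ∅`, tend to `0`. -/
theorem IsLevyBasis.empty (hΛ : IsLevyBasis P Λ) : ∀ᵐ ω ∂P, Λ ∅ ω = 0 := by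
  have h := hΛ.countablyAdditive (fun _ => ∅) (fun _ => IsBoundedBorel.empty)
    (fun _ _ _ => disjoint_bot_left) (by simpa using IsBoundedBorel.empty)
  filter_upwards [h] with ω hω
  have h1 := ((tendsto_add_atTop_iff_nat 1).2 hω).sub hω
  simp only [Finset.sum_range_succ, add_sub_cancel_left, sub_self] at h1
  exact tendsto_nhds_unique tendsto_const_nhds h1

theorem IsLevyBasis.union (hΛ : IsLevyBasis P Λ) {A B : Set (S × ℝ)} (hA : IsBoundedBorel A)
    (hB : IsBoundedBorel B) (hAB : Disjoint A B) :
    ∀ᵐ ω ∂P, Λ (A ∪ B) ω = Λ A ω + Λ B ω := by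
  let C : ℕ → Set (S × ℝ) := fun k => if k = 0 then A else if k = 1 then B else ∅
  have hU : ⋃ k, C k = A ∪ B := by
    ext p
    simp only [Set.mem_iUnion, Set.mem_union, C]
    constructor
    · rintro ⟨k, hk⟩
      split_ifs at hk
      · exact Or.inl hk
      · exact Or.inr hk
      · exact hk.elim
    · rintro (h | h)
      · exact ⟨0, by simpa using h⟩
      · exact ⟨1, by simpa using h⟩
  have h := hΛ.countablyAdditive C (fun k => ?_) (fun k l hkl => ?_) (by
    rw [hU]; exact hA.union hB)
  · rw [hU] at h
    filter_upwards [h, hΛ.empty] with ω hω h0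
    refine tendsto_nhds_unique hω (tendsto_const_nhds.congr' ?_)
    filter_upwards [eventually_ge_atTop 2] with N hN
    obtain ⟨M, rfl⟩ := Nat.exists_eq_add_of_le' hN
    rw [Finset.sum_range_succ', Finset.sum_range_succ']
    simp [C, h0, add_comm]
  · simp only [C]
    split_ifs
    exacts [hA, hB, IsBoundedBorel.empty]
  · simp only [C]
    split_ifs <;> first | omega | simp_all [disjoint_comm]

end Additivity

/-! ### Covariance of the Lévy basis and factorization of `Σ_L`. -/

section Covariance

variable {Ω S : Type*} [MeasurableSpace Ω] [MeasurableSpace S] {d : ℕ}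
  {P : Measure Ω} [IsProbabilityMeasure P]
  {Λ : Set (S × ℝ) → Ω → EuclideanSpace ℝ (Fin d)}
  {γ : EuclideanSpace ℝ (Fin d)} {Sig : Matrix (Fin d) (Fin d) ℝ}
  {ν : Measure (EuclideanSpace ℝ (Fin d))} {π : Measure S}

theorem HasQuadruple.integral_coord_mul_disjoint (hΛ : HasQuadruple P Λ γ Sig ν π)
    (h2 : Integrable (fun x => ‖x‖ ^ 2) ν) (hmean : ∫ ω, levyOne Λ ω ∂P = 0)
    {A B : Set (S × ℝ)} (hA : IsBoundedBorel A) (hB : IsBoundedBorel B) (hAB : Disjoint A B)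
    (a b : Fin d) : ∫ ω, Λ A ω a * Λ B ω b ∂P = 0 := by
  have hi := hΛ.isLevyBasis.indep 2 ![A, B] (by
    intro k; fin_cases k <;> simp [hA, hB]) (by
    intro k l hkl
    fin_cases k <;> fin_cases l <;> simp_all [disjoint_comm])
  have h := hi.indepFun (show (0 : Fin 2) ≠ 1 by decide)
  simp only [Matrix.cons_val_zero, Matrix.cons_val_one] at h
  have h' : IndepFun (fun ω => Λ A ω a) (fun ω => Λ B ω b) P :=
    h.comp (φ := fun x : EuclideanSpace ℝ (Fin d) => x a)
      (ψ := fun x : EuclideanSpace ℝ (Fin d) => x b) (by fun_prop) (by fun_prop)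
  have hmA := hΛ.isLevyBasis.measurable A hA
  have hmB := hΛ.isLevyBasis.measurable B hB
  rw [h'.integral_fun_mul_eq_mul_integral (by fun_prop) (by fun_prop)]
  have := (hΛ.moments_inner h2 hA (EuclideanSpace.single a 1)).2.1
  rw [hΛ.cumulantMean_eq_zero h2 hmean, mul_zero] at this
  simp only [EuclideanSpace.inner_single_left, map_one, one_mul] at this
  rw [this, zero_mul]

/-- Split `A` and `B` along `A ∩ B`. Of the four products of pieces, three involve disjoint sets and
have mean zero; only the square on `A ∩ B` survives. -/
theorem HasQuadruple.covariance (hΛ : HasQuadruple P Λ γ Sig ν π)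
    (h2 : Integrable (fun x => ‖x‖ ^ 2) ν) (hmean : ∫ ω, levyOne Λ ω ∂P = 0)
    {A B : Set (S × ℝ)} (hA : IsBoundedBorel A) (hB : IsBoundedBorel B) (a b : Fin d) :
    ∫ ω, Λ A ω a * Λ B ω b ∂P
      = (π.prod (volume : Measure ℝ)).real (A ∩ B) * SigmaL Sig ν a b := by
  have hC := hA.mono (hA.1.inter hB.1) Set.inter_subset_left
  have hA' := hA.mono (hA.1.diff hB.1) Set.sdiff_subset
  have hB' := hB.mono (hB.1.diff hA.1) Set.sdiff_subset
  have d1 : Disjoint (A ∩ B) (A \ B) := Set.disjoint_sdiff_inter.symm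
  have d2 : Disjoint (A ∩ B) (B \ A) := by
    rw [Set.inter_comm]; exact Set.disjoint_sdiff_inter.symm
  have d3 : Disjoint (A \ B) (B \ A) := disjoint_sdiff_sdiff
  have e1 := hΛ.isLevyBasis.union hC hA' d1
  have e2 := hΛ.isLevyBasis.union hC hB' d2
  rw [Set.inter_union_sdiff] at e1
  rw [Set.inter_comm, Set.inter_union_sdiff, Set.inter_comm] at e2
  have m : ∀ {D : Set (S × ℝ)}, IsBoundedBorel D → ∀ a, MemLp (fun ω => Λ D ω a) 2 P :=
    fun hD a => (hΛ.memLp h2 hD).eval_piLp a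
  have e : ∀ᵐ ω ∂P, Λ A ω a * Λ B ω b = (Λ (A ∩ B) ω a * Λ (A ∩ B) ω b
      + Λ (A ∩ B) ω a * Λ (B \ A) ω b) + (Λ (A \ B) ω a * Λ (A ∩ B) ω b
      + Λ (A \ B) ω a * Λ (B \ A) ω b) := by
    filter_upwards [e1, e2] with ω h1 h2
    rw [h1, h2]
    simp only [PiLp.add_apply]
    ring
  have i : ∀ {D E : Set (S × ℝ)}, IsBoundedBorel D → IsBoundedBorel E →
      Integrable (fun ω => Λ D ω a * Λ E ω b) P :=
    fun hD hE => (m hD a).integrable_mul (m hE b)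
  have i1 : Integrable (fun ω => Λ (A ∩ B) ω a * Λ (A ∩ B) ω b
      + Λ (A ∩ B) ω a * Λ (B \ A) ω b) P := (i hC hC).add (i hC hB')
  have i2 : Integrable (fun ω => Λ (A \ B) ω a * Λ (A ∩ B) ω b
      + Λ (A \ B) ω a * Λ (B \ A) ω b) P := (i hA' hC).add (i hA' hB')
  rw [integral_congr_ae e, integral_add i1 i2,
    integral_add (i hC hC) (i hC hB'), integral_add (i hA' hC) (i hA' hB'),
    hΛ.integral_coord_mul_self h2 hmean hC, hΛ.integral_coord_mul_disjoint h2 hmean hC hB' d2,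
    hΛ.integral_coord_mul_disjoint h2 hmean hA' hC d1.symm,
    hΛ.integral_coord_mul_disjoint h2 hmean hA' hB' d3]
  simp

theorem measure_lt_top_of_isBoundedBorel [IsProbabilityMeasure π] {B : Set (S × ℝ)}
    (hB : IsBoundedBorel B) : (π.prod (volume : Measure ℝ)) B < ⊤ := by
  obtain ⟨-, K, hK⟩ := hB
  refine (measure_mono (t := Set.univ ×ˢ Set.Icc (-K) K) fun p hp => ?_).trans_lt ?_
  · exact ⟨trivial, abs_le.1 (hK p hp)⟩
  · rw [Measure.prod_prod]
    simp

/-- The quadratic form of `Σ_L` is `cumulantVar`, a sum of the nonnegative form of `Sig` and an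
integral of squares. -/
theorem sigmaL_posSemidef (hS : Sig.PosSemidef) (h2 : Integrable (fun x => ‖x‖ ^ 2) ν) :
    (SigmaL Sig ν).PosSemidef := by
  refine Matrix.PosSemidef.of_dotProduct_mulVec_nonneg ?_ fun x => ?_
  · ext a b
    simp [sigmaL_symm hS]
  · have h : cumulantVar Sig ν (WithLp.toLp 2 x) = star x ⬝ᵥ (SigmaL Sig ν).mulVec x := by
      rw [cumulantVar_eq h2]
      simp only [dotProduct, Matrix.mulVec, Finset.mul_sum, star_trivial]
      exact Finset.sum_congr rfl fun a _ => Finset.sum_congr rfl fun b _ => by ring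
    rw [← h, cumulantVar]
    have h1 := hS.dotProduct_mulVec_nonneg x
    have h3 : ⟪WithLp.toLp 2 x, Matrix.toEuclideanLin Sig (WithLp.toLp 2 x)⟫
        = star x ⬝ᵥ Sig.mulVec x := by
      rw [PiLp.inner_apply]
      simp [dotProduct, Matrix.toLpLin_apply, mul_comm]
    rw [h3]
    positivity

-- A positive semidefinite matrix is nonnegative in the C*-algebra of matrices, hence of the form
-- `star Q * Q`. From here on the second-order arguments only need this orthogonality structure.
open scoped MatrixOrder in
theorem HasQuadruple.exists_isOrthogonalBasis (hΛ : HasQuadruple P Λ γ Sig ν π)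
    (h2 : Integrable (fun x => ‖x‖ ^ 2) ν) (hmean : ∫ ω, levyOne Λ ω ∂P = 0) :
    ∃ Q : Matrix (Fin d) (Fin d) ℝ, Qᵀ * Q = SigmaL Sig ν ∧
      IsOrthogonalBasis P (π.prod (volume : Measure ℝ)) Λ Q := by
  have := hΛ.isProbabilityMeasure
  obtain ⟨Q, hQ⟩ := CStarAlgebra.nonneg_iff_eq_star_mul_self.1
    (sigmaL_posSemidef hΛ.posSemidef h2).nonneg
  have hQ' : Qᵀ * Q = SigmaL Sig ν := by
    rw [hQ, Matrix.star_eq_conjTranspose, Matrix.conjTranspose_eq_transpose_of_trivial]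
  refine ⟨Q, hQ', hΛ.isLevyBasis.measurable, fun B hB => hΛ.memLp h2 hB, fun B B' hB hB' a b => ?_,
    fun B hB => (measure_lt_top_of_isBoundedBorel hB).ne⟩
  rw [hQ', hΛ.covariance h2 hmean hB hB']

end Covariance

/-! ### The `L²` isometry for elementary integrals. -/

section Isometry

variable {n d : ℕ}

/-- The linear map `c ↦ c Qᵀ`, with values in matrices with the Euclidean (Frobenius) norm. -/
noncomputable def weight (n : ℕ) (Q : Matrix (Fin d) (Fin d) ℝ) :
    Matrix (Fin n) (Fin d) ℝ →L[ℝ] EuclideanSpace ℝ (Fin n × Fin d) :=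
  LinearMap.toContinuousLinearMap
    { toFun := fun c => WithLp.toLp 2 fun p => (c * Qᵀ) p.1 p.2
      map_add' := fun c c' => by ext p; simp [Matrix.add_mul]
      map_smul' := fun r c => by ext p; simp }

theorem weight_apply (Q : Matrix (Fin d) (Fin d) ℝ) (c : Matrix (Fin n) (Fin d) ℝ)
    (p : Fin n × Fin d) : weight n Q c p = (c * Qᵀ) p.1 p.2 := rfl

theorem inner_weight (Q : Matrix (Fin d) (Fin d) ℝ) (c c' : Matrix (Fin n) (Fin d) ℝ) :
    ⟪weight n Q c, weight n Q c'⟫ = (c * (Qᵀ * Q) * c'ᵀ).trace := by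
  rw [PiLp.inner_apply, Fintype.sum_prod_type, Matrix.trace]
  refine Finset.sum_congr rfl fun i _ => ?_
  rw [← Matrix.mul_assoc, Matrix.mul_assoc, ← Matrix.transpose_transpose Q,
    ← Matrix.transpose_mul, Matrix.transpose_transpose, Matrix.diag_apply, Matrix.mul_apply]
  refine Finset.sum_congr rfl fun j _ => ?_
  simp [weight_apply, mul_comm]

theorem norm_weight_sq (Q : Matrix (Fin d) (Fin d) ℝ) (c : Matrix (Fin n) (Fin d) ℝ) :
    ‖weight n Q c‖ ^ 2 = (c * (Qᵀ * Q) * cᵀ).trace := by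
  rw [← real_inner_self_eq_norm_sq, inner_weight]

variable {Ω S : Type*} [MeasurableSpace Ω] [MeasurableSpace S]
  {P : Measure Ω} {m : Measure (S × ℝ)}
  {Λ : Set (S × ℝ) → Ω → EuclideanSpace ℝ (Fin d)} {Q : Matrix (Fin d) (Fin d) ℝ}

/-- The elementary integral `∑ k, c k · Λ(B k)`; the sets need not be disjoint. -/
noncomputable def elemInt {ι : Type*} [Fintype ι] (Λ : Set (S × ℝ) → Ω → EuclideanSpace ℝ (Fin d))
    (c : ι → Matrix (Fin n) (Fin d) ℝ) (B : ι → Set (S × ℝ)) (ω : Ω) : EuclideanSpace ℝ (Fin n) :=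
  ∑ k, Matrix.toEuclideanLin (c k) (Λ (B k) ω)

/-- The integrand `∑ k, c k 1_{B k}` of an elementary integral. -/
noncomputable def elemFun {ι : Type*} [Fintype ι]
    (c : ι → Matrix (Fin n) (Fin d) ℝ) (B : ι → Set (S × ℝ)) (p : S × ℝ) :
    Matrix (Fin n) (Fin d) ℝ :=
  ∑ k, (B k).indicator (fun _ => c k) p

theorem memLp_toEuclideanLin (hΛ : IsOrthogonalBasis P m Λ Q) (c : Matrix (Fin n) (Fin d) ℝ)
    {B : Set (S × ℝ)} (hB : IsBoundedBorel B) :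
    MemLp (fun ω => Matrix.toEuclideanLin c (Λ B ω)) 2 P :=
  (LinearMap.toContinuousLinearMap (Matrix.toEuclideanLin c)).comp_memLp' (hΛ.memLp B hB)

theorem memLp_weight_indicator (hΛ : IsOrthogonalBasis P m Λ Q) (c : Matrix (Fin n) (Fin d) ℝ)
    {B : Set (S × ℝ)} (hB : IsBoundedBorel B) :
    MemLp (B.indicator fun _ => weight n Q c) 2 m :=
  memLp_indicator_const 2 hB.1 _ (Or.inr (hΛ.finite B hB))

/-- Both sides equal `m(B ∩ B') · tr(c Qᵀ Q c'ᵀ)`. This is the Gram matrix identity behind the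
isometry, and it allows overlapping sets. -/
theorem integral_inner_toEuclideanLin (hΛ : IsOrthogonalBasis P m Λ Q)
    (c c' : Matrix (Fin n) (Fin d) ℝ) {B B' : Set (S × ℝ)} (hB : IsBoundedBorel B)
    (hB' : IsBoundedBorel B') :
    ∫ ω, ⟪Matrix.toEuclideanLin c (Λ B ω), Matrix.toEuclideanLin c' (Λ B' ω)⟫ ∂P
      = ∫ p, ⟪B.indicator (fun _ => weight n Q c) p, B'.indicator (fun _ => weight n Q c') p⟫ ∂m := by
  have hr : ∀ p, ⟪B.indicator (fun _ => weight n Q c) p, B'.indicator (fun _ => weight n Q c') p⟫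
      = (B ∩ B').indicator (fun _ => ⟪weight n Q c, weight n Q c'⟫) p := fun p => by
    by_cases h : p ∈ B <;> by_cases h' : p ∈ B' <;> simp [h, h']
  have hl : ∀ ω, ⟪Matrix.toEuclideanLin c (Λ B ω), Matrix.toEuclideanLin c' (Λ B' ω)⟫
      = ∑ i, ∑ a, ∑ b, c i a * c' i b * (Λ B ω a * Λ B' ω b) := fun ω => by
    rw [PiLp.inner_apply]
    refine Finset.sum_congr rfl fun i _ => ?_
    simp only [Matrix.toLpLin_apply, Matrix.mulVec, dotProduct, RCLike.inner_apply, conj_trivial]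
    rw [mul_comm, Finset.sum_mul_sum]
    exact Finset.sum_congr rfl fun a _ => Finset.sum_congr rfl fun b _ => by ring
  have hi : ∀ i a b, Integrable (fun ω => c i a * c' i b * (Λ B ω a * Λ B' ω b)) P :=
    fun i a b => (((hΛ.memLp B hB).eval_piLp a).integrable_mul
      ((hΛ.memLp B' hB').eval_piLp b)).const_mul _
  rw [integral_congr_ae (ae_of_all _ hr), integral_congr_ae (ae_of_all _ hl),
    integral_indicator_const _ (hB.1.inter hB'.1), inner_weight, Matrix.trace,
    integral_finsetSum _ fun i _ => integrable_finsetSum _ fun a _ =>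
      integrable_finsetSum _ fun b _ => hi i a b, smul_eq_mul, Finset.mul_sum]
  refine Finset.sum_congr rfl fun i _ => ?_
  rw [integral_finsetSum _ fun a _ => integrable_finsetSum _ fun b _ => hi i a b,
    Matrix.diag_apply, Matrix.mul_assoc, Matrix.mul_apply, Finset.mul_sum]
  refine Finset.sum_congr rfl fun a _ => ?_
  rw [integral_finsetSum _ fun b _ => hi i a b, Matrix.mul_apply, Finset.mul_sum, Finset.mul_sum]
  refine Finset.sum_congr rfl fun b _ => ?_
  rw [integral_const_mul, hΛ.covariance B B' hB hB', Matrix.transpose_apply]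
  ring

/-- The `L²` isometry for elementary integrals. -/
theorem eLpNorm_elemInt (hΛ : IsOrthogonalBasis P m Λ Q) {ι : Type*} [Fintype ι]
    (c : ι → Matrix (Fin n) (Fin d) ℝ) {B : ι → Set (S × ℝ)} (hB : ∀ k, IsBoundedBorel (B k)) :
    eLpNorm (elemInt Λ c B) 2 P = eLpNorm (fun p => weight n Q (elemFun c B p)) 2 m := by
  have h := eLpNorm_sum_eq_of_gram (fun k => memLp_toEuclideanLin hΛ (c k) (hB k))
    (fun k => memLp_weight_indicator hΛ (c k) (hB k))
    (fun k l => integral_inner_toEuclideanLin hΛ (c k) (c l) (hB k) (hB l))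
  refine Eq.trans h (congrArg (fun g => eLpNorm g 2 m) (funext fun p => ?_))
  rw [elemFun, map_sum]
  refine Finset.sum_congr rfl fun k _ => ?_
  by_cases hp : p ∈ B k <;> simp [hp]

theorem memLp_elemInt (hΛ : IsOrthogonalBasis P m Λ Q) {ι : Type*} [Fintype ι]
    (c : ι → Matrix (Fin n) (Fin d) ℝ) {B : ι → Set (S × ℝ)} (hB : ∀ k, IsBoundedBorel (B k)) :
    MemLp (elemInt Λ c B) 2 P :=
  memLp_finsetSum _ fun k _ => memLp_toEuclideanLin hΛ (c k) (hB k)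

theorem memLp_elemFun (hΛ : IsOrthogonalBasis P m Λ Q) {ι : Type*} [Fintype ι]
    (c : ι → Matrix (Fin n) (Fin d) ℝ) {B : ι → Set (S × ℝ)} (hB : ∀ k, IsBoundedBorel (B k)) :
    MemLp (elemFun c B) 2 m :=
  memLp_finsetSum _ fun k _ => memLp_indicator_const 2 (hB k).1 _ (Or.inr (hΛ.finite _ (hB k)))

end Isometry

/-! ### Completeness of the measure algebra, for Baire's theorem. -/

section Complete

open scoped symmDiff ENNReal

variable {α : Type*} [MeasurableSpace α]

/-- The measure algebra is complete. -/
instance completeSpace_measuredSets (μ : Measure α) : CompleteSpace (MeasuredSets μ) := by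
  refine EMetric.complete_of_convergent_controlled_sequences (fun n => (2⁻¹ : ℝ≥0∞) ^ n)
    (fun n => ENNReal.pow_pos (by simp) n) fun u hu => ?_
  -- The limit is the upper limit of the sets, along a sequence whose successive distances are below
  -- `2⁻ⁿ`.
  let A : Set α := ⋂ n, ⋃ k, (u (n + k) : Set α)
  have hA : MeasurableSet A :=
    MeasurableSet.iInter fun n => MeasurableSet.iUnion fun k => (u (n + k)).2
  refine ⟨⟨A, hA⟩, tendsto_iff_edist_tendsto_0.2 ?_⟩
  -- A point whose membership never changes from index `n` on belongs to the upper limit exactly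
  -- when it belongs to `u n`; so a point of `u n ∆ A` must switch at some later step.
  have hsub : ∀ n, (u n : Set α) ∆ A ⊆ ⋃ k, (u (n + k) : Set α) ∆ (u (n + (k + 1)) : Set α) := by
    intro n x hx
    by_contra hcon
    simp only [Set.mem_iUnion, not_exists, Set.mem_symmDiff, not_or, not_and, not_not] at hcon
    have hk : ∀ k, x ∈ (u (n + k) : Set α) ↔ x ∈ (u n : Set α) := by
      intro k
      induction k with
      | zero => rfl
      | succ k ih => rw [← ih]; exact ⟨(hcon k).2, (hcon k).1⟩
    have hxA : x ∈ A ↔ x ∈ (u n : Set α) := by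
      simp only [A, Set.mem_iInter, Set.mem_iUnion]
      constructor
      · intro h
        obtain ⟨k, hk'⟩ := h n
        exact (hk k).1 hk'
      · intro h i
        refine ⟨n, ?_⟩
        rw [add_comm]
        exact (hk i).2 h
    rcases hx with hx | hx
    · exact hx.2 (hxA.2 hx.1)
    · exact hx.2 (hxA.1 hx.1)
  have hbound : ∀ n, edist (u n) (⟨A, hA⟩ : MeasuredSets μ) ≤ (2⁻¹ : ℝ≥0∞) ^ n * 2 := by
    intro n
    calc μ ((u n : Set α) ∆ A)
        ≤ μ (⋃ k, (u (n + k) : Set α) ∆ (u (n + (k + 1)) : Set α)) := measure_mono (hsub n)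
      _ ≤ ∑' k, μ ((u (n + k) : Set α) ∆ (u (n + (k + 1)) : Set α)) := measure_iUnion_le _
      _ ≤ ∑' k, (2⁻¹ : ℝ≥0∞) ^ n * 2⁻¹ ^ k := by
          refine ENNReal.tsum_le_tsum fun k => ?_
          rw [← pow_add]
          exact (hu (n + k) _ _ le_rfl (by omega)).le
      _ = (2⁻¹ : ℝ≥0∞) ^ n * 2 := by
          rw [ENNReal.tsum_mul_left, ENNReal.tsum_geometric, ENNReal.one_sub_inv_two, inv_inv]
  refine tendsto_of_tendsto_of_tendsto_of_le_of_le tendsto_const_nhds ?_ (fun _ => zero_le)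
    hbound
  have := ENNReal.Tendsto.mul_const (b := 2)
    (ENNReal.tendsto_pow_atTop_nhds_zero_of_lt_one (r := 2⁻¹) (by simp)) (Or.inr (by simp))
  simpa using this

end Complete

/-! ### A functional metrizing convergence in probability. -/

section TruncNorm

open scoped ENNReal

variable {Ω : Type*} [MeasurableSpace Ω] {P : Measure Ω} {E : Type*} [NormedAddCommGroup E]

/-- The functional `E[min(1, ‖X‖)]`, which metrizes convergence in probability. -/
noncomputable def truncNorm (P : Measure Ω) (X : Ω → E) : ℝ≥0∞ := ∫⁻ ω, min 1 ‖X ω‖ₑ ∂P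

theorem truncNorm_congr {X Y : Ω → E} (h : X =ᵐ[P] Y) : truncNorm P X = truncNorm P Y :=
  lintegral_congr_ae (h.mono fun ω hω => by simp only [hω])

theorem truncNorm_add_le {X Y : Ω → E} (hX : AEStronglyMeasurable X P) :
    truncNorm P (X + Y) ≤ truncNorm P X + truncNorm P Y := by
  rw [truncNorm, truncNorm, truncNorm, ← lintegral_add_left' (aemeasurable_const.min hX.enorm)]
  refine lintegral_mono fun ω => ?_
  calc min 1 ‖X ω + Y ω‖ₑ ≤ min 1 (‖X ω‖ₑ + ‖Y ω‖ₑ) := min_le_min_left _ (enorm_add_le _ _)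
    _ ≤ min 1 ‖X ω‖ₑ + min 1 ‖Y ω‖ₑ := by
      rcases le_total 1 ‖X ω‖ₑ with h | h
      · rw [min_eq_left h]; exact (min_le_left _ _).trans le_self_add
      rcases le_total 1 ‖Y ω‖ₑ with h' | h'
      · rw [min_eq_left h']; exact (min_le_left _ _).trans le_add_self
      · rw [min_eq_right h, min_eq_right h']; exact min_le_right _ _

theorem truncNorm_neg (X : Ω → E) : truncNorm P (-X) = truncNorm P X := by
  simp [truncNorm]

theorem truncNorm_sub_le {X Y : Ω → E} (hX : AEStronglyMeasurable X P) :
    truncNorm P (X - Y) ≤ truncNorm P X + truncNorm P Y := by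
  rw [sub_eq_add_neg, ← truncNorm_neg Y]
  exact truncNorm_add_le hX

theorem truncNorm_le_eLpNorm [IsProbabilityMeasure P] {X : Ω → E}
    (hX : AEStronglyMeasurable X P) : truncNorm P X ≤ eLpNorm X 2 P := by
  refine le_trans ?_ (eLpNorm_le_eLpNorm_of_exponent_le one_le_two hX)
  rw [eLpNorm_one_eq_lintegral_enorm]
  exact lintegral_mono fun ω => min_le_right _ _

theorem tendsto_truncNorm_of_tendstoInMeasure [IsProbabilityMeasure P] {ι : Type*} {l : Filter ι}
    {X : ι → Ω → E} (hX : ∀ i, AEStronglyMeasurable (X i) P)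
    {Y : Ω → E} (hY : AEStronglyMeasurable Y P) (h : TendstoInMeasure P X l Y) :
    Tendsto (fun i => truncNorm P (X i - Y)) l (𝓝 0) := by
  rw [ENNReal.tendsto_nhds_zero]
  intro ε hε
  have h2 : 0 < ε / 2 := ENNReal.half_pos hε.ne'
  filter_upwards [ENNReal.tendsto_nhds_zero.1 (h (ε / 2) h2) (ε / 2) h2] with i hi
  have hd : AEStronglyMeasurable (X i - Y) P := (hX i).sub hY
  have hms : NullMeasurableSet {ω | ε / 2 ≤ ‖(X i - Y) ω‖ₑ} P :=
    nullMeasurableSet_le aemeasurable_const hd.enorm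
  calc truncNorm P (X i - Y)
      ≤ ∫⁻ ω, ({ω | ε / 2 ≤ ‖(X i - Y) ω‖ₑ}.indicator (fun _ => 1) ω + ε / 2) ∂P := by
        refine lintegral_mono fun ω => ?_
        by_cases hω : ε / 2 ≤ ‖(X i - Y) ω‖ₑ
        · rw [Set.indicator_of_mem (show ω ∈ {ω | ε / 2 ≤ ‖(X i - Y) ω‖ₑ} from hω)]
          exact (min_le_left _ _).trans le_self_add
        · exact (min_le_right _ _).trans ((not_le.1 hω).le.trans le_add_self)
    _ = P {ω | ε / 2 ≤ ‖(X i - Y) ω‖ₑ} + ε / 2 := by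
        rw [lintegral_add_right _ measurable_const, lintegral_indicator_const₀ hms]
        simp
    _ ≤ ε / 2 + ε / 2 := by
        gcongr
        simpa [edist_eq_enorm_sub] using hi
    _ = ε := ENNReal.add_halves ε

theorem tendstoInMeasure_of_tendsto_truncNorm {ι : Type*} {l : Filter ι} {X : ι → Ω → E}
    (hX : ∀ i, AEStronglyMeasurable (X i) P)
    (h : Tendsto (fun i => truncNorm P (X i)) l (𝓝 0)) : TendstoInMeasure P X l 0 := by
  refine tendstoInMeasure_of_ne_top fun ε hε hεt => ?_
  -- Markov's inequality is applied to the truncated norm, so the threshold `ε` has to be truncated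
  -- at `1` as well.
  have h0 : min 1 ε ≠ 0 := (lt_min one_pos hε).ne'
  have ht : min 1 ε ≠ ⊤ := (min_le_right _ _).trans_lt hεt.lt_top |>.ne
  have h' : Tendsto (fun i => truncNorm P (X i) / min 1 ε) l (𝓝 0) := by
    have := ENNReal.Tendsto.div_const h (Or.inr h0)
    simpa using this
  refine tendsto_of_tendsto_of_tendsto_of_le_of_le tendsto_const_nhds h' (fun _ => zero_le)
    fun i => ?_
  refine le_trans (measure_mono fun ω hω => ?_)
    (meas_ge_le_lintegral_div (aemeasurable_const.min (hX i).enorm) h0 ht)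
  have hω' : ε ≤ ‖X i ω‖ₑ := by simpa using hω
  exact min_le_min_left _ hω'

end TruncNorm

/-! ### A Vitali-Hahn-Saks theorem for random measures. -/

section VitaliHahnSaks

open scoped ENNReal symmDiff

variable {α Ω E F : Type*} [MeasurableSpace α] [MeasurableSpace Ω]
  [NormedAddCommGroup E] [NormedAddCommGroup F]

/-- The measure with density `‖w‖²` with respect to `m` is finite and absolutely continuous with
respect to `m'`, so it is small on sets of small `m'`-mass. No monotonicity of the sets is needed.
-/
theorem tendsto_eLpNorm_indicator {m m' : Measure α} [SigmaFinite m] [IsFiniteMeasure m']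
    (hmm : m ≪ m') {w : α → F} (hw : MemLp w 2 m) {ι : Type*} {l : Filter ι} {A : ι → Set α}
    (hA : ∀ i, MeasurableSet (A i)) (h : Tendsto (fun i => m' (A i)) l (𝓝 0)) :
    Tendsto (fun i => eLpNorm ((A i).indicator w) 2 m) l (𝓝 0) := by
  set ξ := m.withDensity fun p => ‖w p‖ₑ ^ (2 : ℝ) with hξ
  have hfin : ∫⁻ p, ‖w p‖ₑ ^ (2 : ℝ) ∂m ≠ ⊤ := by
    have := hw.2
    rw [eLpNorm_lt_top_iff_lintegral_rpow_enorm_lt_top (by simp) (by simp)] at this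
    simpa using this.ne
  have : IsFiniteMeasure ξ := isFiniteMeasure_withDensity hfin
  have hac : ξ ≪ m' := (withDensity_absolutelyContinuous _ _).trans hmm
  have hξA : ∀ i, ξ (A i) = ∫⁻ p in A i, ξ.rnDeriv m' p ∂m' := fun i => by
    conv_lhs => rw [← Measure.withDensity_rnDeriv_eq ξ m' hac]
    rw [withDensity_apply _ (hA i)]
  have hlim : Tendsto (fun i => ξ (A i)) l (𝓝 0) := by
    simp_rw [hξA]
    exact tendsto_setLIntegral_zero (Measure.lintegral_rnDeriv_lt_top ξ m').ne h
  have hr := (ENNReal.continuous_rpow_const (y := (1 / 2 : ℝ))).tendsto (0 : ℝ≥0∞)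
  rw [ENNReal.zero_rpow_of_pos (by norm_num)] at hr
  refine (hr.comp hlim).congr fun i => ?_
  rw [eLpNorm_indicator_eq_eLpNorm_restrict (hA i),
    eLpNorm_eq_lintegral_rpow_enorm_toReal (by simp) (by simp)]
  simp only [Function.comp, hξ]
  rw [withDensity_apply _ (hA i)]
  simp

variable {P : Measure Ω}

/-- Additivity gives `D A - D B = D(A \ B) - D(B \ A)`, and both pieces lie in `A ∆ B`. This is what
makes `A ↦ truncNorm P (D A)` continuous on the measure algebra. -/
theorem truncNorm_le_of_additive {D : Set α → Ω → E} {N : Set α → ℝ≥0∞}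
    (hD : ∀ A, MeasurableSet A → AEStronglyMeasurable (D A) P)
    (hadd : ∀ A B, MeasurableSet A → MeasurableSet B → Disjoint A B →
      D (A ∪ B) =ᵐ[P] D A + D B)
    (hN : ∀ A, MeasurableSet A → truncNorm P (D A) ≤ N A)
    (hmono : ∀ A B, A ⊆ B → N A ≤ N B)
    {A B : Set α} (hA : MeasurableSet A) (hB : MeasurableSet B) :
    truncNorm P (D A) ≤ truncNorm P (D B) + (N (A ∆ B) + N (A ∆ B)) := by
  have h1 := hadd (A ∩ B) (A \ B) (hA.inter hB) (hA.diff hB) Set.disjoint_sdiff_inter.symm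
  have h2 := hadd (A ∩ B) (B \ A) (hA.inter hB) (hB.diff hA) (by
    rw [Set.inter_comm]; exact Set.disjoint_sdiff_inter.symm)
  rw [Set.inter_union_sdiff] at h1
  rw [Set.inter_comm, Set.inter_union_sdiff, Set.inter_comm] at h2
  have h3 : D A =ᵐ[P] D B + (D (A \ B) - D (B \ A)) := by
    filter_upwards [h1, h2] with ω h1 h2
    simp only [Pi.add_apply, Pi.sub_apply] at *
    rw [h1, h2]
    abel
  rw [truncNorm_congr h3]
  refine (truncNorm_add_le (hD B hB)).trans ?_
  gcongr
  refine (truncNorm_sub_le (hD _ (hA.diff hB))).trans ?_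
  gcongr
  · exact (hN _ (hA.diff hB)).trans (hmono _ _ Set.subset_union_left)
  · exact (hN _ (hB.diff hA)).trans (hmono _ _ Set.subset_union_right)

variable [IsProbabilityMeasure P] {m : Measure α} [SigmaFinite m] {D : ℕ → Set α → Ω → E} {w : ℕ → α → F}

/-- Vitali-Hahn-Saks for random measures dominated in `L²` by indefinite integrals: pointwise
convergence in probability on all measurable sets implies uniform absolute continuity. -/
theorem exists_delta_truncNorm_le (m' : Measure α) [IsFiniteMeasure m'] (hmm : m ≪ m')
    (hD : ∀ k A, MeasurableSet A → AEStronglyMeasurable (D k A) P)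
    (hadd : ∀ k A B, MeasurableSet A → MeasurableSet B → Disjoint A B →
      D k (A ∪ B) =ᵐ[P] D k A + D k B)
    (hnorm : ∀ k A, MeasurableSet A → eLpNorm (D k A) 2 P ≤ eLpNorm (A.indicator (w k)) 2 m)
    (hw : ∀ k, MemLp (w k) 2 m)
    (hconv : ∀ A, MeasurableSet A → ∃ Z : Ω → E, TendstoInMeasure P (fun k => D k A) atTop Z)
    {ε : ℝ≥0∞} (hε : 0 < ε) :
    ∃ N : ℕ, ∃ δ > 0, ∀ k ≥ N, ∀ A, MeasurableSet A → m' A < δ → truncNorm P (D k A) ≤ ε := by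
  -- Two thirds are spent on `D k - D N`, one third on the single measure `D N`.
  set ε' := ε / 3 with hε'
  have hε'0 : 0 < ε' := ENNReal.div_pos hε.ne' (by simp)
  set M : ℕ → Set α → ℝ≥0∞ := fun k A => eLpNorm (A.indicator (w k)) 2 m with hM
  have hMmono : ∀ k A B, A ⊆ B → M k A ≤ M k B := fun k A B hAB =>
    eLpNorm_mono_enorm fun p => by
      by_cases hp : p ∈ A
      · simp [hp, hAB hp]
      · simp [hp]
  have hDM : ∀ k A, MeasurableSet A → truncNorm P (D k A) ≤ M k A := fun k A hA =>
    (truncNorm_le_eLpNorm (hD k A hA)).trans (hnorm k A hA)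
  have hdiffD : ∀ k l A, MeasurableSet A → AEStronglyMeasurable ((D k - D l) A) P :=
    fun k l A hA => (hD k A hA).sub (hD l A hA)
  have hdiffadd : ∀ k l A B, MeasurableSet A → MeasurableSet B → Disjoint A B →
      (D k - D l) (A ∪ B) =ᵐ[P] (D k - D l) A + (D k - D l) B := fun k l A B hA hB hAB => by
    filter_upwards [hadd k A B hA hB hAB, hadd l A B hA hB hAB] with ω h1 h2
    simp only [Pi.add_apply, Pi.sub_apply] at *
    rw [h1, h2]
    abel
  have hdiffN : ∀ k l A, MeasurableSet A → truncNorm P ((D k - D l) A) ≤ M k A + M l A :=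
    fun k l A hA => (truncNorm_sub_le (hD k A hA)).trans (add_le_add (hDM k A hA) (hDM l A hA))
  -- Baire category: these closed sets cover the complete space of measurable sets, because `D k A`
  -- is Cauchy in probability for every `A`. One of them therefore contains a ball.
  let C : ℕ → Set (MeasuredSets m') := fun N =>
    {A | ∀ k ≥ N, ∀ l ≥ N, truncNorm P ((D k - D l) A) ≤ ε'}
  have hclosed : ∀ N, IsClosed (C N) := by
    intro N
    refine IsSeqClosed.isClosed fun A B hA hAB k hk l hl => ?_
    have hAB' : Tendsto (fun i => m' ((B : Set α) ∆ (A i : Set α))) atTop (𝓝 0) := by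
      have := tendsto_iff_edist_tendsto_0.1 hAB
      refine this.congr fun i => ?_
      rw [edist_comm]
      rfl
    have hms : ∀ i, MeasurableSet ((B : Set α) ∆ (A i : Set α)) := fun i => B.2.symmDiff (A i).2
    have t : ∀ k, Tendsto (fun i => M k ((B : Set α) ∆ (A i : Set α))) atTop (𝓝 0) := fun k =>
      tendsto_eLpNorm_indicator hmm (hw k) hms hAB'
    have t2 := (((t k).add (t l)).add ((t k).add (t l))).const_add ε'
    simp only [add_zero] at t2
    refine ge_of_tendsto' t2 fun i => ?_
    refine (truncNorm_le_of_additive (N := fun A => M k A + M l A) (hdiffD k l) (hdiffadd k l)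
      (hdiffN k l) (fun A B h => add_le_add (hMmono k A B h) (hMmono l A B h)) B.2 (A i).2).trans ?_
    exact add_le_add (hA i k hk l hl) le_rfl
  have hunion : ⋃ N, C N = Set.univ := by
    refine Set.eq_univ_of_forall fun A => ?_
    obtain ⟨Z, hZ⟩ := hconv A A.2
    have hZm : AEStronglyMeasurable Z P := hZ.aestronglyMeasurable fun k => hD k A A.2
    have ht := tendsto_truncNorm_of_tendstoInMeasure (fun k => hD k A A.2) hZm hZ
    obtain ⟨N, hN⟩ := eventually_atTop.1
      (ENNReal.tendsto_nhds_zero.1 ht (ε' / 2) (ENNReal.half_pos hε'0.ne'))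
    refine Set.mem_iUnion.2 ⟨N, fun k hk l hl => ?_⟩
    have : (D k - D l) A = (D k A - Z) - (D l A - Z) := by
      simp
    rw [this]
    refine (truncNorm_sub_le ((hD k A A.2).sub hZm)).trans ?_
    exact (add_le_add (hN k hk) (hN l hl)).trans_eq (ENNReal.add_halves ε')
  have : Nonempty (MeasuredSets m') := ⟨⟨∅, MeasurableSet.empty⟩⟩
  obtain ⟨N, A₀, hA₀⟩ := nonempty_interior_of_iUnion_of_closed hclosed hunion
  obtain ⟨r, hr, hball⟩ := EMetric.mem_nhds_iff.1 (mem_interior_iff_mem_nhds.1 hA₀)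
  -- The estimate on the ball around `A₀` is moved to the origin: a small set `A` is the difference
  -- of `A₀ ∪ A` and `A₀ \ A`, both within distance `r` of `A₀`.
  have key : ∀ k ≥ N, ∀ A, MeasurableSet A → m' A < r →
      truncNorm P ((D k - D N) A) ≤ ε' + ε' := by
    intro k hk A hA hAr
    have hmem : ∀ B : MeasuredSets m', (B : Set α) ∆ A₀ ⊆ A → B ∈ C N := fun B hB =>
      hball ((measure_mono hB).trans_lt hAr)
    have h1 := hmem ⟨A₀ ∪ A, A₀.2.union hA⟩ (by
      intro x hx
      rcases hx with hx | hx
      · exact hx.1.resolve_left hx.2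
      · exact (hx.2 (Or.inl hx.1)).elim) k hk N le_rfl
    have h2 := hmem ⟨A₀ \ A, A₀.2.diff hA⟩ (by
      intro x hx
      rcases hx with hx | hx
      · exact (hx.2 hx.1.1).elim
      · by_contra h
        exact hx.2 ⟨hx.1, h⟩) k hk N le_rfl
    have h3 := hdiffadd k N (A₀ \ A) A (A₀.2.diff hA) hA Set.disjoint_sdiff_left
    rw [Set.sdiff_union_self] at h3
    have h4 : (D k - D N) A =ᵐ[P] (D k - D N) (A₀ ∪ A) - (D k - D N) (A₀ \ A) := by
      filter_upwards [h3] with ω hω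
      simp only [Pi.add_apply, Pi.sub_apply] at *
      rw [hω]
      abel
    rw [truncNorm_congr h4]
    exact (truncNorm_sub_le (hdiffD k N _ (A₀.2.union hA))).trans (add_le_add h1 h2)
  obtain ⟨δ, hδ, hδN⟩ : ∃ δ > 0, ∀ A, MeasurableSet A → m' A < δ → M N A ≤ ε' := by
    by_contra! hcon
    choose A hA hAδ hAM using fun i : ℕ => hcon ((2⁻¹ : ℝ≥0∞) ^ i) (ENNReal.pow_pos (by simp) i)
    have ht : Tendsto (fun i => m' (A i)) atTop (𝓝 0) :=
      tendsto_of_tendsto_of_tendsto_of_le_of_le tendsto_const_nhds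
        (ENNReal.tendsto_pow_atTop_nhds_zero_of_lt_one (r := 2⁻¹) (by simp))
        (fun _ => zero_le) (fun i => (hAδ i).le)
    have := tendsto_eLpNorm_indicator hmm (hw N) hA ht
    obtain ⟨i, hi⟩ := (ENNReal.tendsto_nhds_zero.1 this ε' hε'0).exists
    exact absurd hi (not_le.2 (hAM i))
  refine ⟨N, min r δ, lt_min hr hδ, fun k hk A hA hAr => ?_⟩
  have h1 := key k hk A hA (hAr.trans_le (min_le_left _ _))
  have h2 := (hDM N A hA).trans (hδN A hA (hAr.trans_le (min_le_right _ _)))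
  have h3 : D k A = (D k - D N) A + D N A := by simp
  rw [h3]
  refine (truncNorm_add_le (hdiffD k N A hA)).trans ((add_le_add h1 h2).trans_eq ?_)
  rw [hε', ← ENNReal.add_thirds ε]
  simp [ENNReal.add_thirds]

/-- If the densities tend to zero almost everywhere and the random measures converge in probability
on all measurable sets, then the total masses tend to zero in probability. -/
theorem tendstoInMeasure_zero_of_tendsto_ae
    (hD : ∀ k A, MeasurableSet A → AEStronglyMeasurable (D k A) P)
    (hadd : ∀ k A B, MeasurableSet A → MeasurableSet B → Disjoint A B →
      D k (A ∪ B) =ᵐ[P] D k A + D k B)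
    (hnorm : ∀ k A, MeasurableSet A → eLpNorm (D k A) 2 P ≤ eLpNorm (A.indicator (w k)) 2 m)
    (hw : ∀ k, MemLp (w k) 2 m) (hwm : ∀ k, StronglyMeasurable (w k))
    (hconv : ∀ A, MeasurableSet A → ∃ Z : Ω → E, TendstoInMeasure P (fun k => D k A) atTop Z)
    (h0 : ∀ᵐ p ∂m, Tendsto (fun k => w k p) atTop (𝓝 0)) :
    TendstoInMeasure P (fun k => D k Set.univ) atTop 0 := by
  refine tendstoInMeasure_of_tendsto_truncNorm (fun k => hD k _ MeasurableSet.univ) ?_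
  rw [ENNReal.tendsto_nhds_zero]
  intro ε hε
  have hε2 : 0 < ε / 2 := ENNReal.half_pos hε.ne'
  obtain ⟨N, δ, hδ, hN⟩ := exists_delta_truncNorm_le m.toFinite (absolutelyContinuous_toFinite m)
    hD hadd hnorm hw hconv hε2
  obtain ⟨η, hη, hηδ⟩ : ∃ η : ℝ, 0 < η ∧ ENNReal.ofReal η < δ / 2 := by
    obtain ⟨q, hq, hqδ⟩ := ENNReal.lt_iff_exists_real_btwn.1 (ENNReal.half_pos hδ.ne')
    exact ⟨q, ENNReal.ofReal_pos.1 hqδ.1, hqδ.2⟩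
  -- Egorov's theorem needs a finite measure, so it is applied to `m.toFinite`, which has the same
  -- null sets as `m`. The exceptional set is then enlarged by the complement of a spanning set,
  -- which makes the `m`-mass of the remaining set finite.
  obtain ⟨t, ht, htη, hunif⟩ := tendstoUniformlyOn_of_ae_tendsto' (μ := m.toFinite) hwm
    stronglyMeasurable_zero ((toFinite_absolutelyContinuous m).ae_le h0) hη
  have hspan : Tendsto (fun i => m.toFinite (spanningSets m i)ᶜ) atTop (𝓝 0) := by
    have := tendsto_measure_iInter_atTop (μ := m.toFinite) (s := fun i => (spanningSets m i)ᶜ)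
      (fun i => (measurableSet_spanningSets m i).compl.nullMeasurableSet)
      (fun i j hij => Set.compl_subset_compl.2 (monotone_spanningSets m hij))
      ⟨0, measure_ne_top _ _⟩
    rw [← Set.compl_iUnion, iUnion_spanningSets, Set.compl_univ, measure_empty] at this
    exact this
  obtain ⟨i, hi⟩ := (hspan.eventually (gt_mem_nhds (ENNReal.half_pos hδ.ne'))).exists
  set A : Set α := t ∪ (spanningSets m i)ᶜ with hA
  have hAm : MeasurableSet A := ht.union (measurableSet_spanningSets m i).compl
  have hAδ : m.toFinite A < δ :=
    (measure_union_le _ _).trans_lt ((ENNReal.add_lt_add (htη.trans_lt hηδ) hi).trans_eq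
      (ENNReal.add_halves δ))
  have hAc : m Aᶜ ≠ ⊤ := by
    refine ((measure_mono ?_).trans_lt (measure_spanningSets_lt_top m i)).ne
    rw [hA, Set.compl_union, compl_compl]
    exact Set.inter_subset_right
  -- Off the exceptional set the convergence is uniform on finite `m`-mass, hence holds in `L²`.
  have hsmall : Tendsto (fun k => eLpNorm (Aᶜ.indicator (w k)) 2 m) atTop (𝓝 0) := by
    rw [ENNReal.tendsto_nhds_zero]
    intro ρ hρ
    set V := m Aᶜ ^ (2 : ℝ≥0∞).toReal⁻¹ with hV
    have hVt : V ≠ ⊤ := by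
      rw [hV]
      exact ENNReal.rpow_ne_top_of_nonneg (by positivity) hAc
    have hq : Tendsto (fun x : ℝ => V * ENNReal.ofReal x) (𝓝[>] 0) (𝓝 0) := by
      have h1 : Tendsto (fun x : ℝ => ENNReal.ofReal x) (𝓝[>] 0) (𝓝 (ENNReal.ofReal 0)) :=
        (ENNReal.continuous_ofReal.tendsto 0).mono_left nhdsWithin_le_nhds
      have := ENNReal.Tendsto.const_mul (a := V) h1 (Or.inr hVt)
      simpa using this
    obtain ⟨x, hx, hx0⟩ := ((ENNReal.tendsto_nhds_zero.1 hq ρ hρ).and self_mem_nhdsWithin).exists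
    filter_upwards [Metric.tendstoUniformlyOn_iff.1 hunif x hx0] with k hk
    rw [eLpNorm_indicator_eq_eLpNorm_restrict hAm.compl]
    refine (eLpNorm_le_of_ae_bound (C := x) ?_).trans ?_
    · filter_upwards [ae_restrict_mem hAm.compl] with p hp
      have := hk p (fun h => hp (Or.inl h))
      simpa using this.le
    · rw [Measure.restrict_apply_univ]
      exact hx
  filter_upwards [eventually_ge_atTop N, ENNReal.tendsto_nhds_zero.1 hsmall _ hε2] with k hk hk2
  have h1 := hadd k A Aᶜ hAm hAm.compl disjoint_compl_right
  rw [Set.union_compl_self] at h1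
  rw [truncNorm_congr h1]
  refine (truncNorm_add_le (hD k A hAm)).trans ?_
  refine (add_le_add (hN k hk A hAm hAδ) ?_).trans_eq (ENNReal.add_halves ε)
  exact (truncNorm_le_eLpNorm (hD k _ hAm.compl)).trans ((hnorm k _ hAm.compl).trans hk2)

end VitaliHahnSaks

theorem tendstoInMeasure_sub {Ω E : Type*} [MeasurableSpace Ω] [NormedAddCommGroup E]
    {P : Measure Ω} [IsProbabilityMeasure P] {ι : Type*} {l : Filter ι} [l.NeBot]
    [l.IsCountablyGenerated] {X Y : ι → Ω → E}
    {Z W : Ω → E} (hX : ∀ i, AEStronglyMeasurable (X i) P)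
    (hY : ∀ i, AEStronglyMeasurable (Y i) P) (hXZ : TendstoInMeasure P X l Z)
    (hYW : TendstoInMeasure P Y l W) :
    TendstoInMeasure P (fun i => X i - Y i) l (Z - W) := by
  have hZ := hXZ.aestronglyMeasurable hX
  have hW := hYW.aestronglyMeasurable hY
  have h1 := (tendsto_truncNorm_of_tendstoInMeasure hX hZ hXZ).add
    (tendsto_truncNorm_of_tendstoInMeasure hY hW hYW)
  rw [add_zero] at h1
  have h2 : TendstoInMeasure P (fun i => (X i - Y i) - (Z - W)) l 0 := by
    refine tendstoInMeasure_of_tendsto_truncNorm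
      (fun i => ((hX i).sub (hY i)).sub (hZ.sub hW)) ?_
    refine tendsto_of_tendsto_of_tendsto_of_le_of_le tendsto_const_nhds h1 (fun _ => zero_le)
      fun i => ?_
    change truncNorm P ((X i - Y i) - (Z - W)) ≤ _
    rw [sub_sub_sub_comm]
    exact truncNorm_sub_le ((hX i).sub hZ)
  intro ε hε
  refine (h2 ε hε).congr fun i => ?_
  simp [edist_eq_enorm_sub]

/-! ### Algebra of elementary integrals. -/

section Elementary

section Pointwise

variable {n d : ℕ} {S : Type*} {Q : Matrix (Fin d) (Fin d) ℝ} {ι : Type*} [Fintype ι]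

theorem elemFun_inter (c : ι → Matrix (Fin n) (Fin d) ℝ) (B : ι → Set (S × ℝ))
    (E : Set (S × ℝ)) (p : S × ℝ) :
    elemFun c (fun k => E ∩ B k) p = E.indicator (elemFun c B) p := by
  simp only [elemFun, ← Set.indicator_indicator]
  by_cases hp : p ∈ E <;> simp [elemFun, hp]

theorem weight_indicator (E : Set (S × ℝ)) (g : S × ℝ → Matrix (Fin n) (Fin d) ℝ) :
    (fun p => weight n Q (E.indicator g p)) = E.indicator fun p => weight n Q (g p) := by
  ext1 p
  by_cases hp : p ∈ E <;> simp [hp]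

end Pointwise

variable {n d : ℕ} {Ω S : Type*} [MeasurableSpace Ω] [MeasurableSpace S]
  {P : Measure Ω} {m : Measure (S × ℝ)}
  {Λ : Set (S × ℝ) → Ω → EuclideanSpace ℝ (Fin d)} {Q : Matrix (Fin d) (Fin d) ℝ}
  {ι κ : Type*} [Fintype ι] [Fintype κ]

theorem IsBoundedBorel.inter_left {B : Set (S × ℝ)} (hB : IsBoundedBorel B) {E : Set (S × ℝ)}
    (hE : MeasurableSet E) : IsBoundedBorel (E ∩ B) :=
  hB.mono (hE.inter hB.1) Set.inter_subset_right

theorem stronglyMeasurable_elemFun {c : ι → Matrix (Fin n) (Fin d) ℝ}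
    {B : ι → Set (S × ℝ)} (hB : ∀ k, IsBoundedBorel (B k)) : StronglyMeasurable (elemFun c B) :=
  Finset.stronglyMeasurable_fun_sum _ fun k _ => stronglyMeasurable_const.indicator (hB k).1

/-- A difference of two elementary integrals is one elementary integral indexed by the sum type. Its
sets may overlap, which the isometry permits, so no common refinement is required. -/
theorem eLpNorm_elemInt_sub (hΛ : IsOrthogonalBasis P m Λ Q)
    (c : ι → Matrix (Fin n) (Fin d) ℝ) {B : ι → Set (S × ℝ)} (hB : ∀ k, IsBoundedBorel (B k))
    (c' : κ → Matrix (Fin n) (Fin d) ℝ) {B' : κ → Set (S × ℝ)}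
    (hB' : ∀ k, IsBoundedBorel (B' k)) :
    eLpNorm (elemInt Λ c B - elemInt Λ c' B') 2 P
      = eLpNorm (fun p => weight n Q (elemFun c B p - elemFun c' B' p)) 2 m := by
  have h := eLpNorm_elemInt hΛ (Sum.elim c (-c')) (B := Sum.elim B B') (by
    rintro (k | k)
    · exact hB k
    · exact hB' k)
  have h1 : elemInt Λ (Sum.elim c (-c')) (Sum.elim B B') = elemInt Λ c B - elemInt Λ c' B' := by
    ext1 ω
    simp [elemInt, sub_eq_add_neg]
  have h2 : elemFun (Sum.elim c (-c')) (Sum.elim B B')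
      = fun p => elemFun c B p - elemFun c' B' p := by
    ext1 p
    have : ∀ k, (B' k).indicator (fun _ => -c' k) p = -(B' k).indicator (fun _ => c' k) p :=
      fun k => by by_cases hp : p ∈ B' k <;> simp [hp]
    simp [elemFun, sub_eq_add_neg, this]
  rw [h1, h2] at h
  exact h

/-- The integrands of the two sides agree pointwise, so by the isometry the difference of the
integrals has `L²` norm zero. -/
theorem elemInt_union (hΛ : IsOrthogonalBasis P m Λ Q)
    (c : ι → Matrix (Fin n) (Fin d) ℝ) {B : ι → Set (S × ℝ)} (hB : ∀ k, IsBoundedBorel (B k))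
    {E F : Set (S × ℝ)} (hE : MeasurableSet E) (hF : MeasurableSet F) (hEF : Disjoint E F) :
    elemInt Λ c (fun k => (E ∪ F) ∩ B k)
      =ᵐ[P] elemInt Λ c (fun k => E ∩ B k) + elemInt Λ c (fun k => F ∩ B k) := by
  have hb : ∀ k, IsBoundedBorel (Sum.elim (fun k => E ∩ B k) (fun k => F ∩ B k) k) := by
    rintro (k | k)
    · exact (hB k).inter_left hE
    · exact (hB k).inter_left hF
  have hu : ∀ k, IsBoundedBorel ((E ∪ F) ∩ B k) := fun k => (hB k).inter_left (hE.union hF)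
  have h := eLpNorm_elemInt_sub hΛ c hu (Sum.elim c c) hb
  have h1 : elemInt Λ (Sum.elim c c) (Sum.elim (fun k => E ∩ B k) (fun k => F ∩ B k))
      = elemInt Λ c (fun k => E ∩ B k) + elemInt Λ c (fun k => F ∩ B k) := by
    ext1 ω
    simp [elemInt]
  have h2 : ∀ p, elemFun c (fun k => (E ∪ F) ∩ B k) p
      - elemFun (Sum.elim c c) (Sum.elim (fun k => E ∩ B k) (fun k => F ∩ B k)) p = 0 := by
    intro p
    have : elemFun (Sum.elim c c) (Sum.elim (fun k => E ∩ B k) (fun k => F ∩ B k)) p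
        = elemFun c (fun k => E ∩ B k) p + elemFun c (fun k => F ∩ B k) p := by
      simp [elemFun]
    rw [this, elemFun_inter, elemFun_inter, elemFun_inter, Set.indicator_union_of_disjoint hEF,
      sub_self]
  simp only [h2, map_zero, eLpNorm_zero', h1] at h
  have hm := (memLp_elemInt hΛ c hu).1.sub (memLp_elemInt hΛ (Sum.elim c c) hb).1
  rw [h1] at hm
  rw [eLpNorm_eq_zero_iff hm (by simp)] at h
  exact h.mono fun ω hω => sub_eq_zero.1 hω

end Elementary

/-! ### Approximation of `L²` kernels by simple kernels. -/

section Approximation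

variable {S : Type*} [MeasurableSpace S] {m : Measure (S × ℝ)} [SigmaFinite m]

/-- Simple functions are dense in `L²`, but their level sets may be unbounded in time. Cutting to a
strip `|s| ≤ K` costs little, because the complements of the strips decrease to the empty set. -/
theorem exists_truncated_simpleFunc {G : Type*} [NormedAddCommGroup G] {g : S × ℝ → G}
    (hg : MemLp g 2 m) {ε : ENNReal} (hε : 0 < ε) :
    ∃ (s : SimpleFunc (S × ℝ) G) (K : ℝ),
      eLpNorm (g - {p | |p.2| ≤ K}.indicator s) 2 m < ε := by
  have hε2 : 0 < ε / 2 := ENNReal.half_pos hε.ne'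
  obtain ⟨s, hs, hsm⟩ := hg.exists_simpleFunc_eLpNorm_sub_lt (by simp) hε2.ne'
  have hms : ∀ K : ℕ, MeasurableSet {p : S × ℝ | |p.2| ≤ K} := fun K =>
    measurableSet_le (by fun_prop) measurable_const
  have hlim : Tendsto (fun K : ℕ => m.toFinite {p : S × ℝ | |p.2| ≤ K}ᶜ) atTop (𝓝 0) := by
    have := tendsto_measure_iInter_atTop (μ := m.toFinite)
      (s := fun K : ℕ => {p : S × ℝ | |p.2| ≤ K}ᶜ)
      (fun K => (hms K).compl.nullMeasurableSet)
      (fun i j hij => Set.compl_subset_compl.2 fun p (hp : |p.2| ≤ i) =>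
        hp.trans (by exact_mod_cast hij))
      ⟨0, measure_ne_top _ _⟩
    have hempty : ⋂ K : ℕ, {p : S × ℝ | |p.2| ≤ K}ᶜ = ∅ := by
      rw [← Set.compl_iUnion, Set.compl_empty_iff]
      exact Set.eq_univ_of_forall fun p => Set.mem_iUnion.2 (exists_nat_ge |p.2|)
    rw [hempty, measure_empty] at this
    exact this
  have h := tendsto_eLpNorm_indicator (absolutelyContinuous_toFinite m) hsm
    (fun K => (hms K).compl) hlim
  obtain ⟨K, hK⟩ := (h.eventually (gt_mem_nhds hε2)).exists
  refine ⟨s, K, ?_⟩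
  have he : g - {p | |p.2| ≤ (K : ℝ)}.indicator s
      = (g - s) + {p : S × ℝ | |p.2| ≤ K}ᶜ.indicator s := by
    have := Set.indicator_self_add_compl {p : S × ℝ | |p.2| ≤ (K : ℝ)} s
    rw [sub_add, ← eq_sub_of_add_eq this]
  rw [he]
  refine (eLpNorm_add_le (hg.1.sub hsm.1) (hsm.1.indicator (hms K).compl) one_le_two).trans_lt ?_
  exact (ENNReal.add_lt_add hs hK).trans_eq (ENNReal.add_halves ε)

/-- The level sets of a simple function in the time strip `|s| ≤ K`. -/
def levelSet {G : Type*} (s : SimpleFunc (S × ℝ) G) (K : ℝ) (y : s.range) : Set (S × ℝ) :=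
  {p | |p.2| ≤ K} ∩ s ⁻¹' {(y : G)}

theorem isBoundedBorel_levelSet {G : Type*} (s : SimpleFunc (S × ℝ) G) (K : ℝ) (y : s.range) :
    IsBoundedBorel (levelSet s K y) :=
  ⟨(measurableSet_le (by fun_prop) measurable_const).inter (s.measurableSet_preimage _),
    K, fun _ hp => hp.1⟩

theorem disjoint_levelSet {G : Type*} (s : SimpleFunc (S × ℝ) G) (K : ℝ) {y y' : s.range}
    (h : y ≠ y') : Disjoint (levelSet s K y) (levelSet s K y') := by
  rw [Set.disjoint_left]
  rintro p ⟨-, hp⟩ ⟨-, hp'⟩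
  exact h (Subtype.ext (Eq.trans (Eq.symm hp) hp'))

theorem sum_indicator_levelSet {G M : Type*} [AddCommMonoid M] (s : SimpleFunc (S × ℝ) G) (K : ℝ)
    (a : G → M) (p : S × ℝ) :
    ∑ y : s.range, (levelSet s K y).indicator (fun _ => a y) p
      = {p | |p.2| ≤ K}.indicator (fun p => a (s p)) p := by
  rw [Finset.sum_eq_single ⟨s p, s.mem_range_self p⟩]
  · by_cases hp : |p.2| ≤ K
    · rw [Set.indicator_of_mem (show p ∈ levelSet s K ⟨s p, s.mem_range_self p⟩ from ⟨hp, rfl⟩),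
        Set.indicator_of_mem (show p ∈ {p : S × ℝ | |p.2| ≤ K} from hp)]
    · rw [Set.indicator_of_notMem fun h => hp h.1,
        Set.indicator_of_notMem (show p ∉ {p : S × ℝ | |p.2| ≤ K} from hp)]
  · intro y _ hy
    refine Set.indicator_of_notMem (fun h => hy ?_) _
    exact Subtype.ext (Eq.symm h.2)
  · intro h
    exact absurd (Finset.mem_univ _) h

variable {n d : ℕ}

/-- The simple kernel obtained by truncating a simple function to the time strip `|s| ≤ K`. -/
noncomputable def SimpleKernel.ofSimpleFunc (s : SimpleFunc (S × ℝ) (Matrix (Fin n) (Fin d) ℝ))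
    (K : ℝ) : SimpleKernel S n d where
  size := s.range.card
  coef k := s.range.equivFin.symm k
  supp k := levelSet s K (s.range.equivFin.symm k)
  bounded _ := isBoundedBorel_levelSet s K _
  disjoint _ _ hkl := disjoint_levelSet s K fun h => hkl (s.range.equivFin.symm.injective h)

theorem SimpleKernel.toFun_ofSimpleFunc (s : SimpleFunc (S × ℝ) (Matrix (Fin n) (Fin d) ℝ))
    (K : ℝ) : (SimpleKernel.ofSimpleFunc s K).toFun = {p | |p.2| ≤ K}.indicator s := by
  ext1 p
  refine Eq.trans ?_ (sum_indicator_levelSet s K id p)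
  exact Equiv.sum_comp s.range.equivFin.symm
    (fun y : s.range => (levelSet s K y).indicator (fun _ => (y : Matrix (Fin n) (Fin d) ℝ)) p)

theorem SimpleKernel.toFun_eq_elemFun (φ : SimpleKernel S n d) :
    φ.toFun = elemFun φ.coef φ.supp := rfl

theorem SimpleKernel.stronglyMeasurable (φ : SimpleKernel S n d) : StronglyMeasurable φ.toFun :=
  stronglyMeasurable_elemFun φ.bounded

/-- Square integrable kernels are approximated by simple ones in `L²` and almost everywhere. -/
theorem exists_simpleKernel_seq {g : S × ℝ → Matrix (Fin n) (Fin d) ℝ} (hg : MemLp g 2 m) :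
    ∃ φ : ℕ → SimpleKernel S n d,
      (∀ᵐ p ∂m, Tendsto (fun k => (φ k).toFun p) atTop (𝓝 (g p))) ∧
      Tendsto (fun k => eLpNorm ((φ k).toFun - g) 2 m) atTop (𝓝 0) := by
  choose s K hsK using fun k : ℕ => exists_truncated_simpleFunc (m := m) hg
    (ε := (2⁻¹ : ENNReal) ^ k) (ENNReal.pow_pos (by simp) k)
  have hL : Tendsto (fun k => eLpNorm ((SimpleKernel.ofSimpleFunc (s k) (K k)).toFun - g) 2 m)
      atTop (𝓝 0) := by
    refine tendsto_of_tendsto_of_tendsto_of_le_of_le tendsto_const_nhds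
      (ENNReal.tendsto_pow_atTop_nhds_zero_of_lt_one (r := 2⁻¹) (by simp))
      (fun _ => zero_le) fun k => ?_
    rw [eLpNorm_sub_comm, SimpleKernel.toFun_ofSimpleFunc]
    exact (hsK k).le
  have hM := tendstoInMeasure_of_tendsto_eLpNorm (two_ne_zero)
    (fun k => (SimpleKernel.ofSimpleFunc (s k) (K k)).stronglyMeasurable.aestronglyMeasurable)
    hg.1 hL
  obtain ⟨ns, hns, hae⟩ := hM.exists_seq_tendsto_ae
  exact ⟨fun k => SimpleKernel.ofSimpleFunc (s (ns k)) (K (ns k)), hae,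
    hL.comp hns.tendsto_atTop⟩

end Approximation

/-! ### Existence and uniqueness of the stochastic integral. -/

section Integral

variable {n d : ℕ} {Ω S : Type*} [MeasurableSpace Ω] [MeasurableSpace S]
  {P : Measure Ω} {m : Measure (S × ℝ)}
  {Λ : Set (S × ℝ) → Ω → EuclideanSpace ℝ (Fin d)} {Q : Matrix (Fin d) (Fin d) ℝ}

theorem eLpNorm_weight_le (Q : Matrix (Fin d) (Fin d) ℝ)
    (g : S × ℝ → Matrix (Fin n) (Fin d) ℝ) :
    eLpNorm (fun p => weight n Q (g p)) 2 m ≤ ENNReal.ofReal ‖weight n Q‖ * eLpNorm g 2 m :=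
  eLpNorm_le_mul_eLpNorm_of_ae_le_mul (ae_of_all _ fun p => (weight n Q).le_opNorm (g p)) 2

theorem eLpNorm_indicator_le' {α E : Type*} [MeasurableSpace α] [NormedAddCommGroup E]
    {μ : Measure α} (A : Set α) (g : α → E) (q : ENNReal) :
    eLpNorm (A.indicator g) q μ ≤ eLpNorm g q μ :=
  eLpNorm_mono_enorm fun p => by by_cases hp : p ∈ A <;> simp [hp]

theorem memLp_integral (hΛ : IsOrthogonalBasis P m Λ Q) (φ : SimpleKernel S n d)
    {E : Set (S × ℝ)} (hE : MeasurableSet E) : MemLp (φ.integral Λ E) 2 P :=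
  memLp_elemInt hΛ φ.coef fun k => (φ.bounded k).inter_left hE

/-- The integrals of an `L²`-convergent sequence of simple kernels converge in `L²`. -/
theorem exists_tendsto_eLpNorm_integral (hΛ : IsOrthogonalBasis P m Λ Q)
    {g : S × ℝ → Matrix (Fin n) (Fin d) ℝ} (hg : MemLp g 2 m) {φ : ℕ → SimpleKernel S n d}
    (hφ : Tendsto (fun k => eLpNorm ((φ k).toFun - g) 2 m) atTop (𝓝 0))
    {E : Set (S × ℝ)} (hE : MeasurableSet E) :
    ∃ Z : Ω → EuclideanSpace ℝ (Fin n), MemLp Z 2 P ∧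
      Tendsto (fun k => eLpNorm ((φ k).integral Λ E - Z) 2 P) atTop (𝓝 0) := by
  have hM := fun k => memLp_integral hΛ (φ k) hE
  have hC : CauchySeq fun k => (hM k).toLp := by
    rw [Lp.cauchySeq_Lp_iff_cauchySeq_eLpNorm]
    -- The isometry bounds the distance of two integrals by that of the kernels, up to the operator
    -- norm of `weight`; passing through `g` bounds the latter.
    have hb : Tendsto (fun q : ℕ × ℕ => ENNReal.ofReal ‖weight n Q‖
        * (eLpNorm ((φ q.1).toFun - g) 2 m + eLpNorm ((φ q.2).toFun - g) 2 m)) atTop (𝓝 0) := by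
      have h1 : Tendsto (fun q : ℕ × ℕ => eLpNorm ((φ q.1).toFun - g) 2 m) atTop (𝓝 0) :=
        hφ.comp (by rw [← prod_atTop_atTop_eq]; exact tendsto_fst)
      have h2 : Tendsto (fun q : ℕ × ℕ => eLpNorm ((φ q.2).toFun - g) 2 m) atTop (𝓝 0) :=
        hφ.comp (by rw [← prod_atTop_atTop_eq]; exact tendsto_snd)
      have := ENNReal.Tendsto.const_mul (a := ENNReal.ofReal ‖weight n Q‖) (h1.add h2)
        (Or.inr ENNReal.ofReal_ne_top)
      simpa using this
    refine tendsto_of_tendsto_of_tendsto_of_le_of_le tendsto_const_nhds hb (fun _ => zero_le)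
      fun q => ?_
    have he : eLpNorm (⇑(hM q.1).toLp - ⇑(hM q.2).toLp) 2 P
        = eLpNorm ((φ q.1).integral Λ E - (φ q.2).integral Λ E) 2 P :=
      eLpNorm_congr_ae ((hM q.1).coeFn_toLp.sub (hM q.2).coeFn_toLp)
    dsimp only
    rw [he]
    refine (eLpNorm_elemInt_sub hΛ (φ q.1).coef (fun k => ((φ q.1).bounded k).inter_left hE)
      (φ q.2).coef (fun k => ((φ q.2).bounded k).inter_left hE)).trans_le ?_
    refine (eLpNorm_weight_le Q _).trans ?_
    gcongr
    have h3 : (fun p => elemFun (φ q.1).coef (fun k => E ∩ (φ q.1).supp k) p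
        - elemFun (φ q.2).coef (fun k => E ∩ (φ q.2).supp k) p)
        = E.indicator (((φ q.1).toFun - g) - ((φ q.2).toFun - g)) := by
      ext1 p
      rw [elemFun_inter, elemFun_inter]
      by_cases hp : p ∈ E <;> simp [hp, SimpleKernel.toFun_eq_elemFun]
    rw [h3]
    refine (eLpNorm_indicator_le' _ _ _).trans (eLpNorm_sub_le ?_ ?_ one_le_two)
    · exact (φ q.1).stronglyMeasurable.aestronglyMeasurable.sub hg.1
    · exact (φ q.2).stronglyMeasurable.aestronglyMeasurable.sub hg.1
  obtain ⟨Z, hZ⟩ := cauchySeq_tendsto_of_complete hC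
  refine ⟨Z, Lp.memLp Z, ?_⟩
  rw [Lp.tendsto_Lp_iff_tendsto_eLpNorm'] at hZ
  refine hZ.congr fun k => eLpNorm_congr_ae ?_
  exact (hM k).coeFn_toLp.sub (ae_eq_refl _)

variable {π : Measure S} [SigmaFinite π]

/-- Square integrable kernels are integrable with respect to the Lévy basis. -/
theorem exists_isLevyIntegral
    (hΛ : IsOrthogonalBasis P (π.prod (volume : Measure ℝ)) Λ Q)
    {g : S × ℝ → Matrix (Fin n) (Fin d) ℝ} (hg : MemLp g 2 (π.prod (volume : Measure ℝ))) :
    ∃ Y : Ω → EuclideanSpace ℝ (Fin n), IsLevyIntegral P π Λ g Y := by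
  obtain ⟨φ, hae, hL⟩ := exists_simpleKernel_seq hg
  have key : ∀ E : Set (S × ℝ), MeasurableSet E → ∃ Z : Ω → EuclideanSpace ℝ (Fin n),
      TendstoInMeasure P (fun k => (φ k).integral Λ E) atTop Z := fun E hE => by
    obtain ⟨Z, hZ, hlim⟩ := exists_tendsto_eLpNorm_integral hΛ hg hL hE
    exact ⟨Z, tendstoInMeasure_of_tendsto_eLpNorm two_ne_zero
      (fun k => (memLp_integral hΛ (φ k) hE).1) hZ.1 hlim⟩
  obtain ⟨Y, hY⟩ := key Set.univ MeasurableSet.univ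
  exact ⟨Y, φ, hae, key, hY⟩

/-- A stochastic integral of a square integrable kernel is an `L²` limit of elementary integrals of
kernels converging in `L²`. -/
theorem IsLevyIntegral.exists_tendsto_eLpNorm [IsProbabilityMeasure P]
    (hΛ : IsOrthogonalBasis P (π.prod (volume : Measure ℝ)) Λ Q)
    {g : S × ℝ → Matrix (Fin n) (Fin d) ℝ} (hg : MemLp g 2 (π.prod (volume : Measure ℝ)))
    {Y : Ω → EuclideanSpace ℝ (Fin n)} (hY : IsLevyIntegral P π Λ g Y) :
    MemLp Y 2 P ∧ ∃ ψ : ℕ → SimpleKernel S n d,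
      Tendsto (fun k => eLpNorm ((ψ k).toFun - g) 2 (π.prod (volume : Measure ℝ))) atTop (𝓝 0) ∧
      Tendsto (fun k => eLpNorm ((ψ k).integral Λ Set.univ - Y) 2 P) atTop (𝓝 0) := by
  obtain ⟨φ, hφae, hφE, hφY⟩ := hY
  obtain ⟨ψ, hψae, hψL⟩ := exists_simpleKernel_seq hg
  have hm := fun (θ : SimpleKernel S n d) {E : Set (S × ℝ)} (hE : MeasurableSet E) =>
    (memLp_integral hΛ θ hE).1
  have hψE : ∀ E : Set (S × ℝ), MeasurableSet E → ∃ Z : Ω → EuclideanSpace ℝ (Fin n), MemLp Z 2 P ∧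
      Tendsto (fun k => eLpNorm ((ψ k).integral Λ E - Z) 2 P) atTop (𝓝 0) ∧
      TendstoInMeasure P (fun k => (ψ k).integral Λ E) atTop Z := fun E hE => by
    obtain ⟨Z, hZ, hlim⟩ := exists_tendsto_eLpNorm_integral hΛ hg hψL hE
    exact ⟨Z, hZ, hlim, tendstoInMeasure_of_tendsto_eLpNorm two_ne_zero
      (fun k => hm (ψ k) hE) hZ.1 hlim⟩
  -- The sequence `φ` from the definition is compared with the `L²`-convergent `ψ`. Their integrals
  -- converge in probability on every set and their kernels have the same limit almost everywhere,
  -- so the Vitali-Hahn-Saks argument identifies the two limits.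
  have h0 : TendstoInMeasure P
      (fun k => (φ k).integral Λ Set.univ - (ψ k).integral Λ Set.univ) atTop 0 := by
    refine tendstoInMeasure_zero_of_tendsto_ae (m := π.prod (volume : Measure ℝ))
      (D := fun k E => (φ k).integral Λ E - (ψ k).integral Λ E)
      (w := fun k p => weight n Q ((φ k).toFun p - (ψ k).toFun p))
      (fun k A hA => (hm (φ k) hA).sub (hm (ψ k) hA)) ?_ ?_ ?_ ?_ ?_ ?_
    · intro k A B hA hB hAB
      filter_upwards [elemInt_union hΛ (φ k).coef (φ k).bounded hA hB hAB,
        elemInt_union hΛ (ψ k).coef (ψ k).bounded hA hB hAB] with ω h1 h2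
      have h1' : (φ k).integral Λ (A ∪ B) ω = (φ k).integral Λ A ω + (φ k).integral Λ B ω := h1
      have h2' : (ψ k).integral Λ (A ∪ B) ω = (ψ k).integral Λ A ω + (ψ k).integral Λ B ω := h2
      simp only [Pi.sub_apply, Pi.add_apply, h1', h2']
      abel
    · intro k A hA
      refine (eLpNorm_elemInt_sub hΛ (φ k).coef (fun j => ((φ k).bounded j).inter_left hA)
        (ψ k).coef (fun j => ((ψ k).bounded j).inter_left hA)).le.trans_eq ?_
      rw [← weight_indicator]
      congr 1
      ext1 p
      rw [elemFun_inter, elemFun_inter]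
      by_cases hp : p ∈ A <;> simp [hp, SimpleKernel.toFun_eq_elemFun]
    · intro k
      exact (weight n Q).comp_memLp' ((memLp_elemFun hΛ (φ k).coef (φ k).bounded).sub
        (memLp_elemFun hΛ (ψ k).coef (ψ k).bounded))
    · intro k
      exact (weight n Q).continuous.comp_stronglyMeasurable
        ((φ k).stronglyMeasurable.sub (ψ k).stronglyMeasurable)
    · intro A hA
      obtain ⟨Z, hZ⟩ := hφE A hA
      obtain ⟨W, -, -, hW⟩ := hψE A hA
      exact ⟨Z - W, tendstoInMeasure_sub (fun k => hm (φ k) hA) (fun k => hm (ψ k) hA) hZ hW⟩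
    · filter_upwards [hφae, hψae] with p h1 h2
      have := ((weight n Q).continuous.tendsto _).comp (h1.sub h2)
      rw [sub_self, map_zero] at this
      exact this
  obtain ⟨Z, hZ, hlim, hZm⟩ := hψE Set.univ MeasurableSet.univ
  have hYZ : Y =ᵐ[P] Z := by
    have h1 := tendstoInMeasure_sub (fun k => hm (φ k) MeasurableSet.univ)
      (fun k => hm (ψ k) MeasurableSet.univ) hφY hZm
    exact (tendstoInMeasure_ae_unique h1 h0).mono fun ω hω => sub_eq_zero.1 hω
  refine ⟨hZ.ae_eq hYZ.symm, ψ, hψL, hlim.congr fun k => eLpNorm_congr_ae ?_⟩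
  exact (ae_eq_refl _).sub hYZ.symm

/-- The `L²` distance of a stochastic integral to an elementary integral. -/
theorem IsLevyIntegral.eLpNorm_sub_elemInt_le [IsProbabilityMeasure P]
    (hΛ : IsOrthogonalBasis P (π.prod (volume : Measure ℝ)) Λ Q)
    {g : S × ℝ → Matrix (Fin n) (Fin d) ℝ} (hg : MemLp g 2 (π.prod (volume : Measure ℝ)))
    {Y : Ω → EuclideanSpace ℝ (Fin n)} (hY : IsLevyIntegral P π Λ g Y)
    {ι : Type*} [Fintype ι] (c : ι → Matrix (Fin n) (Fin d) ℝ)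
    {B : ι → Set (S × ℝ)} (hB : ∀ k, IsBoundedBorel (B k)) :
    eLpNorm (Y - elemInt Λ c B) 2 P
      ≤ eLpNorm (fun p => weight n Q (g p - elemFun c B p)) 2 (π.prod (volume : Measure ℝ)) := by
  obtain ⟨hYm, ψ, hψL, hψY⟩ := hY.exists_tendsto_eLpNorm hΛ hg
  set m := π.prod (volume : Measure ℝ) with hm
  set R := eLpNorm (fun p => weight n Q (g p - elemFun c B p)) 2 m with hR
  have hlim : Tendsto (fun k => eLpNorm ((ψ k).integral Λ Set.univ - Y) 2 P
      + (ENNReal.ofReal ‖weight n Q‖ * eLpNorm ((ψ k).toFun - g) 2 m + R)) atTop (𝓝 R) := by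
    have h1 := ENNReal.Tendsto.const_mul (a := ENNReal.ofReal ‖weight n Q‖) hψL
      (Or.inr ENNReal.ofReal_ne_top)
    have := hψY.add (h1.add_const R)
    simpa using this
  refine ge_of_tendsto' hlim fun k => ?_
  have hI := memLp_integral hΛ (ψ k) MeasurableSet.univ
  have hc := memLp_elemInt hΛ c hB
  have hcf := memLp_elemFun hΛ c hB
  have e1 : Y - elemInt Λ c B = (Y - (ψ k).integral Λ Set.univ)
      + ((ψ k).integral Λ Set.univ - elemInt Λ c B) := by abel
  rw [e1]
  refine (eLpNorm_add_le (hYm.1.sub hI.1) (hI.1.sub hc.1) one_le_two).trans ?_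
  rw [eLpNorm_sub_comm Y]
  gcongr
  refine (eLpNorm_elemInt_sub hΛ (ψ k).coef (fun j => ((ψ k).bounded j).inter_left
    MeasurableSet.univ) c hB).le.trans ?_
  have e2 : (fun p => weight n Q (elemFun (ψ k).coef (fun j => Set.univ ∩ (ψ k).supp j) p
      - elemFun c B p)) = (fun p => weight n Q (((ψ k).toFun - g) p))
        + fun p => weight n Q (g p - elemFun c B p) := by
    ext1 p
    rw [elemFun_inter, Set.indicator_univ, Pi.add_apply, ← map_add, Pi.sub_apply,
      SimpleKernel.toFun_eq_elemFun, sub_add_sub_cancel]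
  rw [e2]
  refine (eLpNorm_add_le ?_ ?_ one_le_two).trans ?_
  · exact (weight n Q).continuous.comp_aestronglyMeasurable
      ((ψ k).stronglyMeasurable.aestronglyMeasurable.sub hg.1)
  · exact (weight n Q).continuous.comp_aestronglyMeasurable (hg.1.sub hcf.1)
  · gcongr
    exact eLpNorm_weight_le Q _

end Integral

/-! ### Lipschitz constants and supremum norms. -/

section Lipschitz

variable {n u : ℕ} {F : (Fin u → EuclideanSpace ℝ (Fin n)) → ℝ}

theorem dist₁_nonneg (x y : Fin u → EuclideanSpace ℝ (Fin n)) : 0 ≤ dist₁ x y :=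
  Finset.sum_nonneg fun _ _ => norm_nonneg _

theorem dist₁_le (x y : Fin u → EuclideanSpace ℝ (Fin n)) : dist₁ x y ≤ u * dist x y := by
  calc dist₁ x y ≤ ∑ _a : Fin u, dist x y :=
        Finset.sum_le_sum fun a _ => by rw [← dist_eq_norm]; exact dist_le_pi_dist x y a
    _ = u * dist x y := by simp

theorem IsLip.continuous (hF : IsLip F) : Continuous F := by
  obtain ⟨K, hK⟩ := hF
  refine (LipschitzWith.of_dist_le_mul (K := (|K| * u).toNNReal) fun x y => ?_).continuous
  rw [Real.coe_toNNReal _ (by positivity), Real.dist_eq]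
  calc |F x - F y| ≤ K * dist₁ x y := hK x y
    _ ≤ |K| * (u * dist x y) :=
        mul_le_mul (le_abs_self K) (dist₁_le x y) (dist₁_nonneg x y) (abs_nonneg K)
    _ = |K| * u * dist x y := by ring

theorem lipConst_nonneg : 0 ≤ lipConst F :=
  Real.iSup_nonneg fun _ => div_nonneg (abs_nonneg _) (dist₁_nonneg _ _)

theorem IsLip.abs_sub_le (hF : IsLip F) (x y : Fin u → EuclideanSpace ℝ (Fin n)) :
    |F x - F y| ≤ lipConst F * dist₁ x y := by
  obtain ⟨K, hK⟩ := hF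
  -- At distance zero the quotient in `lipConst` is the default value `0` and carries no
  -- information; the original bound with `K` is used instead.
  rcases (dist₁_nonneg x y).eq_or_lt with h | h
  · have := hK x y
    rw [← h, mul_zero] at this ⊢
    exact this
  · rw [← div_le_iff₀ h]
    refine le_ciSup (f := fun p : (Fin u → EuclideanSpace ℝ (Fin n)) ×
      (Fin u → EuclideanSpace ℝ (Fin n)) => |F p.1 - F p.2| / dist₁ p.1 p.2)
      ⟨|K|, ?_⟩ (x, y)
    rintro _ ⟨p, rfl⟩
    refine div_le_of_le_mul₀ (dist₁_nonneg _ _) (abs_nonneg K) ((hK p.1 p.2).trans ?_)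
    exact mul_le_mul_of_nonneg_right (le_abs_self K) (dist₁_nonneg _ _)

theorem abs_le_supNorm (h1 : ∀ x, |F x| ≤ 1) (x : Fin u → EuclideanSpace ℝ (Fin n)) :
    |F x| ≤ supNorm F :=
  le_ciSup (f := fun x => |F x|) ⟨1, by rintro _ ⟨y, rfl⟩; exact h1 y⟩ x

theorem supNorm_nonneg : 0 ≤ supNorm F := Real.iSup_nonneg fun _ => abs_nonneg _

theorem IsLip.aestronglyMeasurable_comp {Ω : Type*} [MeasurableSpace Ω] {P : Measure Ω}
    (hF : IsLip F) {X : Fin u → Ω → EuclideanSpace ℝ (Fin n)}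
    (hX : ∀ a, AEStronglyMeasurable (X a) P) :
    AEStronglyMeasurable (fun ω => F fun a => X a ω) P :=
  (hF.continuous.measurable.comp_aemeasurable
    (aemeasurable_pi_lambda _ fun a => (hX a).aemeasurable)).aestronglyMeasurable

end Lipschitz

/-! ### Covariances of nearly independent variables. -/

section CovarianceBound

variable {Ω : Type*} [MeasurableSpace Ω] {P : Measure Ω} [IsProbabilityMeasure P]

theorem integral_norm_le_toReal_eLpNorm {E : Type*} [NormedAddCommGroup E] {X : Ω → E}
    (hX : MemLp X 2 P) : ∫ ω, ‖X ω‖ ∂P ≤ (eLpNorm X 2 P).toReal := by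
  rw [integral_norm_eq_lintegral_enorm hX.1, ← eLpNorm_one_eq_lintegral_enorm]
  exact ENNReal.toReal_mono hX.2.ne (eLpNorm_le_eLpNorm_of_exponent_le one_le_two hX.1)

/-- The covariance of bounded variables that are close to independent ones is small. -/
theorem abs_covariance_le_of_indepFun {a a' b b' : Ω → ℝ} {A B : ℝ}
    (ha : AEStronglyMeasurable a P) (ha' : AEStronglyMeasurable a' P)
    (hb : AEStronglyMeasurable b P) (hb' : AEStronglyMeasurable b' P)
    (haA : ∀ ω, |a ω| ≤ A) (haA' : ∀ ω, |a' ω| ≤ A) (hbB : ∀ ω, |b ω| ≤ B)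
    (hbB' : ∀ ω, |b' ω| ≤ B) (hi : IndepFun a' b' P) :
    |cov[a, b; P]| ≤ 2 * (B * ∫ ω, |a ω - a' ω| ∂P + A * ∫ ω, |b ω - b' ω| ∂P) := by
  have mem : ∀ {x : Ω → ℝ} {C : ℝ}, AEStronglyMeasurable x P → (∀ ω, |x ω| ≤ C) →
      MemLp x 2 P := fun hx hC => MemLp.of_bound hx _ (ae_of_all _ hC)
  have la := mem ha haA
  have la' := mem ha' haA'
  have lb := mem hb hbB
  have lb' := mem hb' hbB'
  have i1 := fun {x : Ω → ℝ} (h : MemLp x 2 P) => h.integrable one_le_two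
  have ida : Integrable (fun ω => |a ω - a' ω|) P := (i1 (la.sub la')).abs
  have idb : Integrable (fun ω => |b ω - b' ω|) P := (i1 (lb.sub lb')).abs
  have h0 := hi.covariance_eq_zero la' lb'
  rw [covariance_eq_sub la' lb'] at h0
  have eA : ∀ {x : Ω → ℝ} {C : ℝ}, (∀ ω, |x ω| ≤ C) → |∫ ω, x ω ∂P| ≤ C := fun {x C} hC => by
    have := norm_integral_le_of_norm_le_const (μ := P) (f := x) (C := C) (ae_of_all _ hC)
    simpa using this
  have hdm : |∫ ω, a ω ∂P - ∫ ω, a' ω ∂P| ≤ ∫ ω, |a ω - a' ω| ∂P := by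
    rw [← integral_sub (i1 la) (i1 la')]
    exact abs_integral_le_integral_abs
  have hdb : |∫ ω, b ω ∂P - ∫ ω, b' ω ∂P| ≤ ∫ ω, |b ω - b' ω| ∂P := by
    rw [← integral_sub (i1 lb) (i1 lb')]
    exact abs_integral_le_integral_abs
  have hprod : |∫ ω, (a * b) ω ∂P - ∫ ω, (a' * b') ω ∂P|
      ≤ B * ∫ ω, |a ω - a' ω| ∂P + A * ∫ ω, |b ω - b' ω| ∂P := by
    rw [← integral_sub (la.integrable_mul lb) (la'.integrable_mul lb'), ← integral_const_mul,
      ← integral_const_mul, ← integral_add (ida.const_mul B) (idb.const_mul A)]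
    refine abs_integral_le_integral_abs.trans (integral_mono
      ((la.integrable_mul lb).sub (la'.integrable_mul lb')).abs
      ((ida.const_mul B).add (idb.const_mul A)) fun ω => ?_)
    have : (a * b) ω - (a' * b') ω = b ω * (a ω - a' ω) + a' ω * (b ω - b' ω) := by
      simp only [Pi.mul_apply]; ring
    simp only [this]
    refine (abs_add_le _ _).trans ?_
    rw [abs_mul, abs_mul]
    gcongr
    · exact hbB ω
    · exact haA' ω
  have hmul : |(∫ ω, a ω ∂P) * ∫ ω, b ω ∂P - (∫ ω, a' ω ∂P) * ∫ ω, b' ω ∂P|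
      ≤ B * ∫ ω, |a ω - a' ω| ∂P + A * ∫ ω, |b ω - b' ω| ∂P := by
    have : (∫ ω, a ω ∂P) * ∫ ω, b ω ∂P - (∫ ω, a' ω ∂P) * ∫ ω, b' ω ∂P
        = (∫ ω, b ω ∂P) * (∫ ω, a ω ∂P - ∫ ω, a' ω ∂P)
          + (∫ ω, a' ω ∂P) * (∫ ω, b ω ∂P - ∫ ω, b' ω ∂P) := by ring
    rw [this]
    refine (abs_add_le _ _).trans ?_
    rw [abs_mul, abs_mul]
    exact add_le_add (mul_le_mul (eA hbB) hdm (abs_nonneg _) ((abs_nonneg _).trans (eA hbB)))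
      (mul_le_mul (eA haA') hdb (abs_nonneg _) ((abs_nonneg _).trans (eA haA')))
  -- The covariance of `a'` and `b'` vanishes and may be subtracted. The mean of the product and the
  -- product of the means each contribute the same error, hence the factor `2`.
  rw [covariance_eq_sub la lb]
  calc |∫ ω, (a * b) ω ∂P - (∫ ω, a ω ∂P) * ∫ ω, b ω ∂P|
      = |(∫ ω, (a * b) ω ∂P - ∫ ω, (a' * b') ω ∂P)
        - ((∫ ω, a ω ∂P) * ∫ ω, b ω ∂P - (∫ ω, a' ω ∂P) * ∫ ω, b' ω ∂P)| := by
        congr 1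
        linarith
    _ ≤ _ := (abs_sub _ _).trans (by linarith)

variable {n u : ℕ} {F : (Fin u → EuclideanSpace ℝ (Fin n)) → ℝ}

theorem IsLip.integral_abs_sub_le (hF : IsLip F) {X U : Fin u → Ω → EuclideanSpace ℝ (Fin n)}
    (hX : ∀ a, MemLp (X a) 2 P) (hU : ∀ a, MemLp (U a) 2 P) {η : ℝ}
    (h : ∀ a, (eLpNorm (X a - U a) 2 P).toReal ≤ η) :
    ∫ ω, |(F fun a => X a ω) - F fun a => U a ω| ∂P ≤ lipConst F * (u * η) := by
  have hi : ∀ a, Integrable (fun ω => ‖X a ω - U a ω‖) P := fun a =>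
    (((hX a).sub (hU a)).integrable one_le_two).norm
  have hi' : Integrable (fun ω => lipConst F * ∑ a, ‖X a ω - U a ω‖) P :=
    (integrable_finsetSum _ fun a _ => hi a).const_mul _
  calc ∫ ω, |(F fun a => X a ω) - F fun a => U a ω| ∂P
      ≤ ∫ ω, lipConst F * ∑ a, ‖X a ω - U a ω‖ ∂P := by
        refine integral_mono_of_nonneg (ae_of_all _ fun ω => abs_nonneg _) hi'
          (ae_of_all _ fun ω => hF.abs_sub_le _ _)
    _ = lipConst F * ∑ a, ∫ ω, ‖X a ω - U a ω‖ ∂P := by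
        rw [integral_const_mul, integral_finsetSum _ fun a _ => hi a]
    _ ≤ lipConst F * ∑ _a : Fin u, η := by
        refine mul_le_mul_of_nonneg_left (Finset.sum_le_sum fun a _ => ?_) lipConst_nonneg
        exact (integral_norm_le_toReal_eLpNorm ((hX a).sub (hU a))).trans (h a)
    _ = lipConst F * (u * η) := by simp

end CovarianceBound

/-! ### Independence of integrals over disjoint regions. -/

section Independence

variable {n d : ℕ} {Ω S : Type*} [MeasurableSpace Ω] [MeasurableSpace S]
  {P : Measure Ω} {Λ : Set (S × ℝ) → Ω → EuclideanSpace ℝ (Fin d)}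

/-- The pieces `E ∩ L k` and `F ∩ L k`, indexed by `ι × Bool`, are pairwise disjoint, so `Λ` is
jointly independent on them; grouping by the Boolean gives the two independent blocks. -/
theorem IsLevyBasis.indepFun_inter (hΛ : IsLevyBasis P Λ) {ι : Type*} [Fintype ι]
    {L : ι → Set (S × ℝ)} (hL : ∀ k, IsBoundedBorel (L k))
    (hd : Pairwise fun k l => Disjoint (L k) (L l)) {E F : Set (S × ℝ)} (hE : MeasurableSet E)
    (hF : MeasurableSet F) (hEF : Disjoint E F) :
    IndepFun (fun ω (k : ι) => Λ (E ∩ L k) ω) (fun ω (k : ι) => Λ (F ∩ L k) ω) P := by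
  classical
  let B : ι × Bool → Set (S × ℝ) := fun q => (bif q.2 then E else F) ∩ L q.1
  have hB : ∀ q, IsBoundedBorel (B q) := by
    rintro ⟨k, _ | _⟩
    · exact (hL k).inter_left hF
    · exact (hL k).inter_left hE
  have hBd : Pairwise fun q q' => Disjoint (B q) (B q') := by
    rintro ⟨k, b⟩ ⟨l, b'⟩ hne
    by_cases hkl : k = l
    · subst hkl
      cases b <;> cases b'
      · exact absurd rfl hne
      · exact hEF.symm.mono Set.inter_subset_left Set.inter_subset_left
      · exact hEF.mono Set.inter_subset_left Set.inter_subset_left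
      · exact absurd rfl hne
    · exact (hd hkl).mono Set.inter_subset_right Set.inter_subset_right
  let e := Fintype.equivFin (ι × Bool)
  have h1 := hΛ.indep _ (fun j => B (e.symm j)) (fun j => hB _)
    (fun i j hij => hBd fun h => hij (e.symm.injective h))
  have h2 : iIndepFun (fun q => Λ (B q)) P := by
    have := h1.precomp e.injective
    simpa using this
  have h3 := h2.indepFun_finset (Finset.univ.filter fun q => q.2 = true)
    (Finset.univ.filter fun q => q.2 = false) (by
      rw [Finset.disjoint_left]
      intro q h h'
      simp_all) (fun q => hΛ.measurable _ (hB q))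
  exact h3.comp (φ := fun z (k : ι) => z ⟨(k, true), by simp⟩)
    (ψ := fun z (k : ι) => z ⟨(k, false), by simp⟩)
    (measurable_pi_lambda _ fun _ => measurable_pi_apply _)
    (measurable_pi_lambda _ fun _ => measurable_pi_apply _)

theorem measurable_sum_toEuclideanLin {ι τ : Type*} [Fintype ι]
    (c : τ → ι → Matrix (Fin n) (Fin d) ℝ) :
    Measurable fun (z : ι → EuclideanSpace ℝ (Fin d)) (a : τ) =>
      ∑ y, Matrix.toEuclideanLin (c a y) (z y) := by
  refine measurable_pi_lambda _ fun a => Finset.measurable_fun_sum _ fun y _ => ?_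
  exact (LinearMap.continuous_of_finiteDimensional _).measurable.comp (measurable_pi_apply y)

theorem IsLevyBasis.indepFun_elemInt (hΛ : IsLevyBasis P Λ) {ι : Type*} [Fintype ι]
    {L : ι → Set (S × ℝ)} (hL : ∀ k, IsBoundedBorel (L k))
    (hd : Pairwise fun k l => Disjoint (L k) (L l)) {E F : Set (S × ℝ)} (hE : MeasurableSet E)
    (hF : MeasurableSet F) (hEF : Disjoint E F) {κ κ' : Type*}
    (c : κ → ι → Matrix (Fin n) (Fin d) ℝ) (c' : κ' → ι → Matrix (Fin n) (Fin d) ℝ) :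
    IndepFun (fun ω a => elemInt Λ (c a) (fun k => E ∩ L k) ω)
      (fun ω b => elemInt Λ (c' b) (fun k => F ∩ L k) ω) P :=
  (hΛ.indepFun_inter hL hd hE hF hEF).comp (measurable_sum_toEuclideanLin c)
    (measurable_sum_toEuclideanLin c')

variable {π : Measure S} [SigmaFinite π] [IsProbabilityMeasure P] {Q : Matrix (Fin d) (Fin d) ℝ}

/-- Split `g - 1_E φ = 1_{Eᶜ} g + 1_E (g - φ)`: the mass of `g` lost outside `E`, plus the
approximation error of the simple kernel `φ`. -/
theorem IsLevyIntegral.eLpNorm_sub_elemInt_inter_le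
    (hΛ : IsOrthogonalBasis P (π.prod (volume : Measure ℝ)) Λ Q)
    {g : S × ℝ → Matrix (Fin n) (Fin d) ℝ} (hg : MemLp g 2 (π.prod (volume : Measure ℝ)))
    {Y : Ω → EuclideanSpace ℝ (Fin n)} (hY : IsLevyIntegral P π Λ g Y)
    {ι : Type*} [Fintype ι] (c : ι → Matrix (Fin n) (Fin d) ℝ)
    {L : ι → Set (S × ℝ)} (hL : ∀ k, IsBoundedBorel (L k)) {E : Set (S × ℝ)}
    (hE : MeasurableSet E) :
    eLpNorm (Y - elemInt Λ c fun k => E ∩ L k) 2 P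
      ≤ eLpNorm (Eᶜ.indicator fun p => weight n Q (g p)) 2 (π.prod (volume : Measure ℝ))
        + ENNReal.ofReal ‖weight n Q‖ * eLpNorm (g - elemFun c L) 2
          (π.prod (volume : Measure ℝ)) := by
  refine (hY.eLpNorm_sub_elemInt_le hΛ hg c fun k => (hL k).inter_left hE).trans ?_
  have hcf := memLp_elemFun hΛ c hL
  have e : (fun p => weight n Q (g p - elemFun c (fun k => E ∩ L k) p))
      = (Eᶜ.indicator fun p => weight n Q (g p))
        + E.indicator fun p => weight n Q ((g - elemFun c L) p) := by
    ext1 p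
    rw [elemFun_inter]
    by_cases hp : p ∈ E <;> simp [hp]
  have m1 : AEStronglyMeasurable (fun p => weight n Q (g p)) (π.prod (volume : Measure ℝ)) :=
    (weight n Q).continuous.comp_aestronglyMeasurable hg.1
  have m2 : AEStronglyMeasurable (fun p => weight n Q ((g - elemFun c L) p))
      (π.prod (volume : Measure ℝ)) :=
    (weight n Q).continuous.comp_aestronglyMeasurable (hg.1.sub hcf.1)
  rw [e]
  refine (eLpNorm_add_le (m1.indicator hE.compl) (m2.indicator hE) one_le_two).trans ?_
  gcongr
  exact (eLpNorm_indicator_le' _ _ _).trans (eLpNorm_weight_le Q _)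

/-- Two finite families of stochastic integrals are approximated by independent families of
elementary integrals over disjoint sets `E` and `F`. -/
theorem exists_indepFun_approx (hLB : IsLevyBasis P Λ)
    (hΛ : IsOrthogonalBasis P (π.prod (volume : Measure ℝ)) Λ Q)
    {κ κ' : Type*} [Fintype κ] [Fintype κ']
    {g : κ → S × ℝ → Matrix (Fin n) (Fin d) ℝ} {g' : κ' → S × ℝ → Matrix (Fin n) (Fin d) ℝ}
    (hg : ∀ a, MemLp (g a) 2 (π.prod (volume : Measure ℝ)))
    (hg' : ∀ b, MemLp (g' b) 2 (π.prod (volume : Measure ℝ)))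
    {X : κ → Ω → EuclideanSpace ℝ (Fin n)} {Y : κ' → Ω → EuclideanSpace ℝ (Fin n)}
    (hX : ∀ a, IsLevyIntegral P π Λ (g a) (X a)) (hY : ∀ b, IsLevyIntegral P π Λ (g' b) (Y b))
    {E F : Set (S × ℝ)} (hE : MeasurableSet E) (hF : MeasurableSet F) (hEF : Disjoint E F)
    {ε : ENNReal} (hε : 0 < ε) :
    ∃ (U : κ → Ω → EuclideanSpace ℝ (Fin n)) (V : κ' → Ω → EuclideanSpace ℝ (Fin n)),
      (∀ a, MemLp (U a) 2 P) ∧ (∀ b, MemLp (V b) 2 P) ∧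
      IndepFun (fun ω a => U a ω) (fun ω b => V b ω) P ∧
      (∀ a, eLpNorm (X a - U a) 2 P
        ≤ eLpNorm (Eᶜ.indicator fun p => weight n Q (g a p)) 2 (π.prod (volume : Measure ℝ))
          + ENNReal.ofReal ‖weight n Q‖ * ε) ∧
      (∀ b, eLpNorm (Y b - V b) 2 P
        ≤ eLpNorm (Fᶜ.indicator fun p => weight n Q (g' b p)) 2 (π.prod (volume : Measure ℝ))
          + ENNReal.ofReal ‖weight n Q‖ * ε) := by
  set m := π.prod (volume : Measure ℝ)
  -- All kernels are approximated at once, as one vector-valued function. They then share a single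
  -- family of disjoint level sets, as joint independence of the two blocks requires.
  let H : S × ℝ → κ ⊕ κ' → Matrix (Fin n) (Fin d) ℝ := fun p =>
    Sum.elim (fun a => g a p) (fun b => g' b p)
  have hH : MemLp H 2 m := by
    refine MemLp.of_eval fun q => ?_
    rcases q with a | b
    · exact hg a
    · exact hg' b
  obtain ⟨s, K, hs⟩ := exists_truncated_simpleFunc hH hε
  let L : s.range → Set (S × ℝ) := levelSet s K
  have hL : ∀ y, IsBoundedBorel (L y) := isBoundedBorel_levelSet s K
  let U : κ → Ω → EuclideanSpace ℝ (Fin n) := fun a =>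
    elemInt Λ (fun y : s.range => y.1 (Sum.inl a)) fun y => E ∩ L y
  let V : κ' → Ω → EuclideanSpace ℝ (Fin n) := fun b =>
    elemInt Λ (fun y : s.range => y.1 (Sum.inr b)) fun y => F ∩ L y
  have happ : ∀ q : κ ⊕ κ', eLpNorm ((fun p => H p q)
      - elemFun (fun y : s.range => y.1 q) L) 2 m ≤ ε := by
    intro q
    refine le_trans (eLpNorm_mono fun p => ?_) hs.le
    have h1 : elemFun (fun y : s.range => y.1 q) L p
        = ({p | |p.2| ≤ K}.indicator s p) q := by
      refine (sum_indicator_levelSet s K (fun y => y q) p).trans ?_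
      by_cases hp : |p.2| ≤ K
      · rw [Set.indicator_of_mem (show p ∈ {p : S × ℝ | |p.2| ≤ K} from hp),
          Set.indicator_of_mem (show p ∈ {p : S × ℝ | |p.2| ≤ K} from hp)]
      · rw [Set.indicator_of_notMem (show p ∉ {p : S × ℝ | |p.2| ≤ K} from hp),
          Set.indicator_of_notMem (show p ∉ {p : S × ℝ | |p.2| ≤ K} from hp)]
        rfl
    rw [Pi.sub_apply, h1]
    exact norm_le_pi_norm ((H - {p | |p.2| ≤ K}.indicator s) p) q
  refine ⟨U, V, fun a => memLp_elemInt hΛ _ fun y => (hL y).inter_left hE,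
    fun b => memLp_elemInt hΛ _ fun y => (hL y).inter_left hF, ?_, fun a => ?_, fun b => ?_⟩
  · exact hLB.indepFun_elemInt hL (fun y y' h => disjoint_levelSet s K h) hE hF hEF
      (fun a y => y.1 (Sum.inl a)) (fun b y => y.1 (Sum.inr b))
  · refine ((hX a).eLpNorm_sub_elemInt_inter_le hΛ (hg a) _ hL hE).trans ?_
    gcongr
    exact happ (Sum.inl a)
  · refine ((hY b).eLpNorm_sub_elemInt_inter_le hΛ (hg' b) _ hL hF).trans ?_
    gcongr
    exact happ (Sum.inr b)

end Independence

/-! ### Time shifts and tails of `L²` kernels. -/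

section Tails

variable {S : Type*} [MeasurableSpace S] {π : Measure S} [IsProbabilityMeasure π]
  {E : Type*} [NormedAddCommGroup E] {h : S × ℝ → E}

theorem measurePreserving_reflect (π : Measure S) [SFinite π] (t : ℝ) :
    MeasurePreserving (fun p : S × ℝ => (p.1, t - p.2)) (π.prod (volume : Measure ℝ))
      (π.prod volume) :=
  (MeasurePreserving.id π).prod (Measure.measurePreserving_sub_left volume t)

theorem measurePreserving_shift (π : Measure S) [SFinite π] (t : ℝ) :
    MeasurePreserving (fun p : S × ℝ => (p.1, p.2 - t)) (π.prod (volume : Measure ℝ))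
      (π.prod volume) :=
  (MeasurePreserving.id π).prod (measurePreserving_sub_right volume t)

/-- Lebesgue measure is translation invariant, so the shift can be undone. The inclusion is only
required almost everywhere, which lets endpoints of time intervals be ignored. -/
theorem eLpNorm_indicator_shift_le (hh : MemLp h 2 (π.prod (volume : Measure ℝ)))
    (t : ℝ) {A : Set (S × ℝ)} {T : Set ℝ} (hT : MeasurableSet T)
    (hAT : ∀ᵐ p ∂π.prod (volume : Measure ℝ), p ∈ A → p.2 - t ∈ T) :
    eLpNorm (A.indicator fun p => h (p.1, p.2 - t)) 2 (π.prod (volume : Measure ℝ))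
      ≤ eLpNorm ({p : S × ℝ | p.2 ∈ T}.indicator h) 2 (π.prod (volume : Measure ℝ)) := by
  have hTm : MeasurableSet {p : S × ℝ | p.2 ∈ T} := measurable_snd hT
  rw [← eLpNorm_comp_measurePreserving (hh.1.indicator hTm) (measurePreserving_shift π t)]
  refine eLpNorm_mono_ae ?_
  filter_upwards [hAT] with p hp
  by_cases hpA : p ∈ A
  · rw [Set.indicator_of_mem hpA, Function.comp, Set.indicator_of_mem (by exact hp hpA)]
  · rw [Set.indicator_of_notMem hpA, norm_zero]
    exact norm_nonneg _

theorem ae_snd_ne (x : ℝ) : ∀ᵐ p ∂π.prod (volume : Measure ℝ), p.2 ≠ x := by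
  have : {p : S × ℝ | ¬ p.2 ≠ x} = Set.univ ×ˢ {x} := by ext p; simp
  rw [ae_iff, this, Measure.prod_prod]
  simp

theorem sqrt_integral_integral_eq (hh : MemLp h 2 (π.prod (volume : Measure ℝ))) {T : Set ℝ}
    (hT : MeasurableSet T) :
    √(∫ A, (∫ s in T, ‖h (A, s)‖ ^ 2) ∂π)
      = (eLpNorm ({p : S × ℝ | p.2 ∈ T}.indicator h) 2 (π.prod (volume : Measure ℝ))).toReal := by
  have hTm : MeasurableSet {p : S × ℝ | p.2 ∈ T} := measurable_snd hT
  have hs : {p : S × ℝ | p.2 ∈ T} = Set.univ ×ˢ T := by ext p; simp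
  have hint : Integrable (fun p => ‖h p‖ ^ 2) (π.prod (volume : Measure ℝ)) :=
    (memLp_two_iff_integrable_sq_norm hh.1).1 hh
  rw [(hh.indicator hTm).eLpNorm_eq_integral_rpow_norm (by simp) (by simp), ENNReal.toReal_ofReal
    (by positivity), Real.sqrt_eq_rpow]
  simp only [ENNReal.toReal_ofNat, Real.rpow_ofNat, one_div]
  congr 1
  have h1 : ∀ p, ‖{p : S × ℝ | p.2 ∈ T}.indicator h p‖ ^ 2
      = {p : S × ℝ | p.2 ∈ T}.indicator (fun p => ‖h p‖ ^ 2) p := fun p => by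
    by_cases hp : p.2 ∈ T <;> simp [hp]
  simp_rw [h1]
  rw [integral_indicator hTm, hs, setIntegral_prod _ hint.integrableOn, setIntegral_univ]

/-- The time sets decrease to the empty set, so their masses under a finite measure dominating `m`
tend to zero. -/
theorem tendsto_toReal_eLpNorm_tail (hh : MemLp h 2 (π.prod (volume : Measure ℝ)))
    {T : ℝ → Set ℝ} (hT : ∀ r, MeasurableSet (T r)) (hanti : Antitone T)
    (hempty : ⋂ r, T r = ∅) :
    Tendsto (fun r => (eLpNorm ({p : S × ℝ | p.2 ∈ T r}.indicator h) 2
      (π.prod (volume : Measure ℝ))).toReal) atTop (𝓝 0) := by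
  set m := π.prod (volume : Measure ℝ)
  have hTm : ∀ r, MeasurableSet {p : S × ℝ | p.2 ∈ T r} := fun r => measurable_snd (hT r)
  have hlim : Tendsto (fun r => m.toFinite {p : S × ℝ | p.2 ∈ T r}) atTop (𝓝 0) := by
    have := tendsto_measure_iInter_atTop (μ := m.toFinite)
      (s := fun r : ℝ => {p : S × ℝ | p.2 ∈ T r}) (fun r => (hTm r).nullMeasurableSet)
      (fun r r' hr p hp => hanti hr hp) ⟨0, measure_ne_top _ _⟩
    have he : ⋂ r, {p : S × ℝ | p.2 ∈ T r} = ∅ := by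
      have : ⋂ r, {p : S × ℝ | p.2 ∈ T r} = Prod.snd ⁻¹' (⋂ r, T r) := by
        ext p; simp
      rw [this, hempty, Set.preimage_empty]
    rw [he, measure_empty] at this
    exact this
  have h0 := (ENNReal.tendsto_toReal ENNReal.zero_ne_top).comp
    (tendsto_eLpNorm_indicator (absolutelyContinuous_toFinite m) hh hTm hlim)
  rw [ENNReal.toReal_zero] at h0
  exact h0

end Tails

theorem traceKernel_eq {S : Type*} {n d : ℕ} (f : S × ℝ → Matrix (Fin n) (Fin d) ℝ)
    (Q : Matrix (Fin d) (Fin d) ℝ) (A : S) (s : ℝ) :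
    traceKernel f (Qᵀ * Q) A s = ‖weight n Q (f (A, -s))‖ ^ 2 := by
  rw [norm_weight_sq, traceKernel]

/-! ### The coefficients `η_X` as `L²` tail norms. -/

section Eta

variable {S : Type*} [MeasurableSpace S] {π : Measure S} [IsProbabilityMeasure π] {n d : ℕ}
  {f : S × ℝ → Matrix (Fin n) (Fin d) ℝ} {Q : Matrix (Fin d) (Fin d) ℝ}

theorem memLp_reflect (hf : MemLp f 2 (π.prod (volume : Measure ℝ))) (t : ℝ) :
    MemLp (fun p => f (p.1, t - p.2)) 2 (π.prod (volume : Measure ℝ)) :=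
  hf.comp_measurePreserving (measurePreserving_reflect π t)

theorem memLp_weight_neg (hf : MemLp f 2 (π.prod (volume : Measure ℝ))) :
    MemLp (fun p : S × ℝ => weight n Q (f (p.1, -p.2))) 2 (π.prod (volume : Measure ℝ)) := by
  have := (weight n Q).comp_memLp' (memLp_reflect hf 0)
  simpa [Function.comp_def] using this

theorem etaCoeff_eq (hf : MemLp f 2 (π.prod (volume : Measure ℝ))) (r : ℝ) :
    etaCoeff π f (Qᵀ * Q) r
      = (eLpNorm ({p : S × ℝ | p.2 ∈ {s : ℝ | 2 * s < -r}}.indicator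
          fun p => weight n Q (f (p.1, -p.2))) 2 (π.prod (volume : Measure ℝ))).toReal
        + (eLpNorm ({p : S × ℝ | p.2 ∈ {s : ℝ | r < 2 * s}}.indicator
          fun p => weight n Q (f (p.1, -p.2))) 2 (π.prod (volume : Measure ℝ))).toReal := by
  rw [etaCoeff]
  simp_rw [traceKernel_eq]
  rw [← sqrt_integral_integral_eq (memLp_weight_neg hf) (measurableSet_lt (by fun_prop)
    (by fun_prop)), ← sqrt_integral_integral_eq (memLp_weight_neg hf)
    (measurableSet_lt (by fun_prop) (by fun_prop))]

theorem tendsto_etaCoeff (hf : MemLp f 2 (π.prod (volume : Measure ℝ))) :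
    Tendsto (etaCoeff π f (Qᵀ * Q)) atTop (𝓝 0) := by
  have h1 := tendsto_toReal_eLpNorm_tail (memLp_weight_neg (Q := Q) hf)
    (T := fun r => {s : ℝ | 2 * s < -r}) (fun r => measurableSet_lt (by fun_prop) (by fun_prop))
    (fun r r' hr s (hs : 2 * s < -r') => show 2 * s < -r by linarith) (by
      refine Set.eq_empty_of_forall_notMem fun s hs => ?_
      have : 2 * s < -(-(2 * s)) := Set.mem_iInter.1 hs (-(2 * s))
      linarith)
  have h2 := tendsto_toReal_eLpNorm_tail (memLp_weight_neg (Q := Q) hf)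
    (T := fun r => {s : ℝ | r < 2 * s}) (fun r => measurableSet_lt (by fun_prop) (by fun_prop))
    (fun r r' hr s (hs : r' < 2 * s) => show r < 2 * s by linarith) (by
      refine Set.eq_empty_of_forall_notMem fun s hs => ?_
      have : 2 * s < 2 * s := Set.mem_iInter.1 hs (2 * s)
      linarith)
  have h3 := h1.add h2
  rw [add_zero] at h3
  exact h3.congr fun r => (etaCoeff_eq hf r).symm

end Eta

/-! ### Weak dependence of the mixed moving average. -/

section WeakDependence

variable {n d : ℕ} {Ω S : Type*} [MeasurableSpace Ω] [MeasurableSpace S]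
  {P : Measure Ω} [IsProbabilityMeasure P] {π : Measure S} [IsProbabilityMeasure π]
  {Λ : Set (S × ℝ) → Ω → EuclideanSpace ℝ (Fin d)} {Q : Matrix (Fin d) (Fin d) ℝ}
  {f : S × ℝ → Matrix (Fin n) (Fin d) ℝ} {X : ℝ → Ω → EuclideanSpace ℝ (Fin n)}

/-- Cut at time `τ`. The past variables lose only noise after `τ`, at lag at least `r/2` beyond
their own time, and the future variables only noise up to `τ`. What remains is carried by disjoint
regions and is independent up to arbitrarily small simple approximation. -/
theorem IsMMA.abs_covariance_le (hLB : IsLevyBasis P Λ)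
    (hΛ : IsOrthogonalBasis P (π.prod (volume : Measure ℝ)) Λ Q)
    (hf : MemLp f 2 (π.prod (volume : Measure ℝ))) (hX : IsMMA P π Λ f X) {u v : ℕ} {r τ : ℝ}
    {i : Fin u → ℝ} {j : Fin v → ℝ} (hi : ∀ a, i a + r / 2 ≤ τ) (hj : ∀ b, τ + r / 2 ≤ j b)
    {F : (Fin u → EuclideanSpace ℝ (Fin n)) → ℝ} {G : (Fin v → EuclideanSpace ℝ (Fin n)) → ℝ}
    (hF : IsLip F) (hG : IsLip G) (hF1 : ∀ x, |F x| ≤ 1) (hG1 : ∀ x, |G x| ≤ 1) :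
    |cov[fun ω => F (fun a => X (i a) ω), fun ω => G (fun b => X (j b) ω); P]|
      ≤ 2 * (u * lipConst F * supNorm G + v * lipConst G * supNorm F)
        * etaCoeff π f (Qᵀ * Q) r := by
  set m := π.prod (volume : Measure ℝ)
  set h : S × ℝ → EuclideanSpace ℝ (Fin n × Fin d) := fun p => weight n Q (f (p.1, -p.2))
  have hh : MemLp h 2 m := memLp_weight_neg hf
  have hlow : MeasurableSet {s : ℝ | 2 * s < -r} := measurableSet_lt (by fun_prop) (by fun_prop)
  have hup : MeasurableSet {s : ℝ | r < 2 * s} := measurableSet_lt (by fun_prop) (by fun_prop)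
  set α := eLpNorm ({p : S × ℝ | p.2 ∈ {s : ℝ | 2 * s < -r}}.indicator h) 2 m
  set β := eLpNorm ({p : S × ℝ | p.2 ∈ {s : ℝ | r < 2 * s}}.indicator h) 2 m
  have hα : α ≠ ⊤ := (hh.indicator (measurable_snd hlow)).2.ne
  have hβ : β ≠ ⊤ := (hh.indicator (measurable_snd hup)).2.ne
  have hη : etaCoeff π f (Qᵀ * Q) r = α.toReal + β.toReal := etaCoeff_eq hf r
  set E : Set (S × ℝ) := {p | p.2 ≤ τ} with hE
  have hEm : MeasurableSet E := measurableSet_le (by fun_prop) (by fun_prop)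
  have hshift : ∀ t, (fun p : S × ℝ => weight n Q (f (p.1, t - p.2)))
      = fun p => h (p.1, p.2 - t) := fun t => by
    ext1 p
    simp only [h, neg_sub]
  have tailX : ∀ a, eLpNorm (Eᶜ.indicator fun p => weight n Q (f (p.1, i a - p.2))) 2 m ≤ β := by
    intro a
    rw [hshift]
    refine eLpNorm_indicator_shift_le hh (i a) hup (ae_of_all _ fun p hp => ?_)
    have hp' : τ < p.2 := not_le.1 hp
    have := hi a
    change r < 2 * (p.2 - i a)
    linarith
  have tailY : ∀ b, eLpNorm (Eᶜᶜ.indicator fun p => weight n Q (f (p.1, j b - p.2))) 2 m ≤ α := by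
    intro b
    rw [hshift]
    refine eLpNorm_indicator_shift_le hh (j b) hlow ?_
    -- The region `E` contains the slice `s = τ`, where only `2(s - j b) ≤ -r` holds; this null
    -- slice is discarded to get the strict inequality in `etaCoeff`.
    filter_upwards [ae_snd_ne τ] with p hne hp
    rw [compl_compl] at hp
    have hp' : p.2 < τ := lt_of_le_of_ne hp hne
    have := hj b
    change 2 * (p.2 - j b) < -r
    linarith
  have hXm : ∀ t, MemLp (X t) 2 P := fun t =>
    ((hX t).exists_tendsto_eLpNorm hΛ (memLp_reflect hf t)).1
  set C := ‖weight n Q‖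
  have hC : 0 ≤ C := norm_nonneg (weight n Q)
  -- Here `δ` is the error of the simple approximation; it is sent to `0` at the end.
  have key : ∀ δ : ℝ, 0 < δ →
      |cov[fun ω => F (fun a => X (i a) ω), fun ω => G (fun b => X (j b) ω); P]|
        ≤ 2 * (u * lipConst F * supNorm G + v * lipConst G * supNorm F)
          * (etaCoeff π f (Qᵀ * Q) r + C * δ) := by
    intro δ hδ
    obtain ⟨U, V, hU, hV, hind, hXU, hYV⟩ := exists_indepFun_approx hLB hΛ
      (fun a => memLp_reflect hf (i a)) (fun b => memLp_reflect hf (j b)) (fun a => hX (i a))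
      (fun b => hX (j b)) hEm hEm.compl disjoint_compl_right (ENNReal.ofReal_pos.2 hδ)
    have bound : ∀ {x y z : ENNReal}, z ≠ ⊤ → x ≤ y + ENNReal.ofReal C * ENNReal.ofReal δ →
        y ≤ z → x.toReal ≤ z.toReal + C * δ := fun {x y z} hz hx hy => by
      refine (ENNReal.toReal_mono (by finiteness) (hx.trans (add_le_add_left hy _))).trans_eq ?_
      rw [ENNReal.toReal_add hz (by finiteness), ENNReal.toReal_mul, ENNReal.toReal_ofReal hC,
        ENNReal.toReal_ofReal hδ.le]
    have hx := hF.integral_abs_sub_le (fun a => hXm (i a)) hU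
      (fun a => bound hβ (hXU a) (tailX a))
    have hy := hG.integral_abs_sub_le (fun b => hXm (j b)) hV
      (fun b => bound hα (hYV b) (tailY b))
    have hcov := abs_covariance_le_of_indepFun (P := P)
      (hF.aestronglyMeasurable_comp fun a => (hXm (i a)).1)
      (hF.aestronglyMeasurable_comp fun a => (hU a).1)
      (hG.aestronglyMeasurable_comp fun b => (hXm (j b)).1)
      (hG.aestronglyMeasurable_comp fun b => (hV b).1)
      (fun ω => abs_le_supNorm hF1 _) (fun ω => abs_le_supNorm hF1 _)
      (fun ω => abs_le_supNorm hG1 _) (fun ω => abs_le_supNorm hG1 _)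
      (hind.comp hF.continuous.measurable hG.continuous.measurable)
    refine hcov.trans ?_
    have hα0 : 0 ≤ α.toReal := ENNReal.toReal_nonneg
    have hβ0 : 0 ≤ β.toReal := ENNReal.toReal_nonneg
    have hsF : 0 ≤ supNorm F := supNorm_nonneg
    have hsG : 0 ≤ supNorm G := supNorm_nonneg
    have hlF : 0 ≤ lipConst F := lipConst_nonneg
    have hlG : 0 ≤ lipConst G := lipConst_nonneg
    rw [hη, mul_assoc]
    refine mul_le_mul_of_nonneg_left ?_ zero_le_two
    have h1 : supNorm G * (lipConst F * (u * (β.toReal + C * δ)))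
        ≤ u * lipConst F * supNorm G * (α.toReal + β.toReal + C * δ) := by
      calc supNorm G * (lipConst F * (u * (β.toReal + C * δ)))
          = u * lipConst F * supNorm G * (β.toReal + C * δ) := by ring
        _ ≤ _ := by gcongr; linarith
    have h2 : supNorm F * (lipConst G * (v * (α.toReal + C * δ)))
        ≤ v * lipConst G * supNorm F * (α.toReal + β.toReal + C * δ) := by
      calc supNorm F * (lipConst G * (v * (α.toReal + C * δ)))
          = v * lipConst G * supNorm F * (α.toReal + C * δ) := by ring
        _ ≤ _ := by gcongr; linarith
    rw [add_mul]
    exact add_le_add ((mul_le_mul_of_nonneg_left hx hsG).trans h1)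
      ((mul_le_mul_of_nonneg_left hy hsF).trans h2)
  have hlim : Tendsto (fun δ : ℝ => 2 * (u * lipConst F * supNorm G + v * lipConst G * supNorm F)
      * (etaCoeff π f (Qᵀ * Q) r + C * δ)) (𝓝[>] 0)
      (𝓝 (2 * (u * lipConst F * supNorm G + v * lipConst G * supNorm F)
        * (etaCoeff π f (Qᵀ * Q) r + C * 0))) :=
    (Continuous.tendsto (by fun_prop) 0).mono_left nhdsWithin_le_nhds
  rw [mul_zero, add_zero] at hlim
  refine ge_of_tendsto hlim ?_
  filter_upwards [self_mem_nhdsWithin] with δ hδ using key δ hδ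

theorem IsMMA.isEtaWeaklyDependent (hLB : IsLevyBasis P Λ)
    (hΛ : IsOrthogonalBasis P (π.prod (volume : Measure ℝ)) Λ Q)
    (hf : MemLp f 2 (π.prod (volume : Measure ℝ))) (hX : IsMMA P π Λ f X) :
    IsEtaWeaklyDependent P X (etaCoeff π f (Qᵀ * Q)) := by
  refine ⟨tendsto_etaCoeff hf, 2, fun u v hu _ r hr i j hi _ hij F G hF hG hF1 hG1 => ?_⟩
  -- The cut is at `i_u + r/2`, with `i_u` the latest past time; the gap condition leaves at least
  -- `r/2` before every future time.
  let last : Fin u := ⟨u - 1, by omega⟩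
  refine hX.abs_covariance_le hLB hΛ hf (τ := i last + r / 2) (fun a => ?_) (fun b => ?_)
    hF hG hF1 hG1
  · have : i a ≤ i last := hi (Fin.le_def.2 (by simp only [last]; omega))
    linarith
  · linarith [hij last b]

end WeakDependence

end LevyMMA

theorem mainTheorem1 {Ω S : Type*} [MeasurableSpace Ω]
    [TopologicalSpace S] [MeasurableSpace S] [BorelSpace S] {n d : ℕ}
    (P : Measure Ω) [IsProbabilityMeasure P]
    (Λ : Set (S × ℝ) → Ω → EuclideanSpace ℝ (Fin d))
    (γ : EuclideanSpace ℝ (Fin d)) (Sig : Matrix (Fin d) (Fin d) ℝ)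
    (ν : Measure (EuclideanSpace ℝ (Fin d))) (π : Measure S)
    (hΛ : LevyMMA.HasQuadruple P Λ γ Sig ν π)
    (hmean : ∫ ω, LevyMMA.levyOne Λ ω ∂P = 0)
    (hmoment : IntegrableOn (fun x => ‖x‖ ^ 2) {x | 1 < ‖x‖} ν)
    (f : S × ℝ → Matrix (Fin n) (Fin d) ℝ)
    (hf : ∀ a b, Measurable fun p => f p a b)
    (hf2 : MemLp f 2 (π.prod (volume : Measure ℝ))) :
    -- `L_1` is square integrable and `E[L_1 L_1ᵀ] = Σ_L`
    (MemLp (LevyMMA.levyOne Λ) 2 P ∧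
      (∀ a b, Integrable (fun x : EuclideanSpace ℝ (Fin d) => x a * x b) ν) ∧
      (∀ a b, ∫ ω, LevyMMA.levyOne Λ ω a * LevyMMA.levyOne Λ ω b ∂P
        = LevyMMA.SigmaL Sig ν a b)) ∧
    -- the integrals in the coefficients are finite
    Integrable (fun p : S × ℝ => LevyMMA.traceKernel f (LevyMMA.SigmaL Sig ν) p.1 p.2)
      (π.prod (volume : Measure ℝ)) ∧
    -- the process is well defined
    (∃ X : ℝ → Ω → EuclideanSpace ℝ (Fin n), LevyMMA.IsMMA P π Λ f X) ∧
    -- it is weakly dependent with the stated coefficients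
    (∀ X : ℝ → Ω → EuclideanSpace ℝ (Fin n), LevyMMA.IsMMA P π Λ f X →
      LevyMMA.IsEtaWeaklyDependent P X
        (LevyMMA.etaCoeff π f (LevyMMA.SigmaL Sig ν))) := by
  have := hΛ.isProbabilityMeasure
  have h2 := LevyMMA.integrable_norm_sq hΛ.isLevyMeasure hmoment
  obtain ⟨Q, hQ, hO⟩ := hΛ.exists_isOrthogonalBasis h2 hmean
  refine ⟨⟨hΛ.memLp h2 LevyMMA.isBoundedBorel_unit, LevyMMA.integrable_coord_mul h2,
    fun a b => ?_⟩, ?_, ?_, fun X hX => ?_⟩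
  · have := hΛ.integral_coord_mul_self h2 hmean LevyMMA.isBoundedBorel_unit a b
    rw [LevyMMA.measureReal_unit, one_mul] at this
    exact this
  · rw [← hQ]
    simp_rw [LevyMMA.traceKernel_eq]
    have hw := LevyMMA.memLp_weight_neg (Q := Q) hf2
    exact (memLp_two_iff_integrable_sq_norm hw.1).1 hw
  · choose X hX using fun t : ℝ => LevyMMA.exists_isLevyIntegral hO (LevyMMA.memLp_reflect hf2 t)
    exact ⟨X, hX⟩
  · rw [← hQ]
    exact hX.isEtaWeaklyDependent hΛ.isLevyBasis hO hf2
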